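/- Let $\Sigma$ be an oriented surface, possibly disconnected, non-compact or with boundary, and let $D$ be a link diagram on $\Sigma$. A state $S$ of $D$ is a choice of an $A$- or $B$-smoothing at each crossing; it determines a system of disjoint simple loops in $\Sigma$, also denoted $S$. Let $S_A$ and $S_B$ be the pure $A$ and pure $B$ states, and call two states adjacent if they differ at exactly one crossing. Let $|S|$ be the number of loops of $S$, $t(S)$ the number of loops of $S$ that are contractible in $\Sigma$, $\widehat S$ the multi-loop obtained from $S$ by removing the contractible loops, considered up to isotopy in $\Sigma$, and $k(S)$ the rank of the kernel of the map $H_1(S;\mathbb Z/2)\to H_1(\Sigma;\mathbb Z/2)$ induced by inclusion. For $X\in\{A,B\}$, the diagram $D$ is (skein) $X$-adequate if every state $S$ adjacent to $S_X$ satisfies $t(S)\le t(S_X)$ or $\widehat S\ne\widehat S_X$ (as isotopy classes); it is homologically $X$-adequate if $k(S)\le k(S_X)$ for every state $S$ adjacent to $S_X$. It is plus-adequate (respectively minus-adequate) if $|S|=|S_X|-1$ for every state $S$ adjacent to $S_X$, where $X=A$ (respectively $X=B$). Then: if $D$ is homologically $A$-adequate, it is $A$-adequate; if $D$ is homologically $B$-adequate,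 it is $B$-adequate; if $D$ is plus-adequate, it is $A$-adequate; and if $D$ is minus-adequate, it is $B$-adequate. -/

import Mathlib

open scoped Topology unitInterval

universe u

/-! ## Oriented surfaces -/

/-- A map `f` between (subsets of) the plane preserves the orientation at `p`: the image of every
small positively oriented circle around `p` winds exactly once, positively, around `f p`. The
winding number is expressed by a continuous choice `θ` of the argument. -/
def PreservesOrientationAt (f : ℂ → ℂ) (p : ℂ) : Prop :=
  ∀ᶠ r : ℝ in 𝓝[>] 0, ∃ θ : ℝ → ℝ, Continuous θ ∧
    (∀ τ, θ (τ + 2 * Real.pi) = θ τ + 2 * Real.pi) ∧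
    ∀ τ : ℝ, f (p + r * Complex.exp (τ * Complex.I)) - f p =
      ‖f (p + r * Complex.exp (τ * Complex.I)) - f p‖ * Complex.exp (θ τ * Complex.I)

/-- Two planar charts induce the same orientation on their common domain. -/
def SameOrientation {X : Type u} [TopologicalSpace X] (e e' : OpenPartialHomeomorph X ℂ) : Prop :=
  ∀ x ∈ e.source ∩ e'.source, PreservesOrientationAt (fun z => e' (e.symm z)) (e x)

/-- An orientation of a topological surface (possibly with boundary): planar charts which cover
the interior (the set of all points in the domain of some planar chart) and whose coordinate
changes preserve the orientation of the plane. -/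
structure SurfaceOrientation (X : Type u) [TopologicalSpace X] where
  /-- the positively oriented charts -/
  charts : Set (OpenPartialHomeomorph X ℂ)
  covers : ∀ (e : OpenPartialHomeomorph X ℂ), ∀ x ∈ e.source, ∃ e' ∈ charts, x ∈ e'.source
  compatible : ∀ e ∈ charts, ∀ e' ∈ charts, SameOrientation e e'

/-! ## Link diagrams -/

/-- A link diagram on the oriented surface `X`: a 4-valent graph in `X`, possibly together with
closed loops without vertices, with crossing information at each vertex. Every vertex (crossing)
`c` comes with a positively oriented chart that contains the closed unit disc; inside this disc the
diagram consists of the two coordinate axes, the real axis being the overstrand and the imaginary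
axis the understrand. The four points where the diagram leaves the disc are the points
`1, I, -1, -I = I ^ k`, `k = 0, 1, 2, 3`. Outside the (pairwise disjoint) discs the diagram
consists of disjoint embedded arcs, whose endpoints are matched by `ends` with the `4 n` points on
the boundaries of the discs, and of finitely many disjoint embedded loops. -/
structure LinkDiagram (X : Type u) [TopologicalSpace X] (o : SurfaceOrientation X) where
  /-- the number of crossings -/
  crossings : ℕ
  /-- the number of components without crossings -/
  freeLoops : ℕ
  /-- the chart around a crossing -/
  chart : Fin crossings → OpenPartialHomeomorph X ℂ
  chart_oriented : ∀ c, ∀ e ∈ o.charts, SameOrientation (chart c) e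
  closedBall_subset : ∀ c, Metric.closedBall (0 : ℂ) 1 ⊆ (chart c).target
  disjoint_discs : Pairwise fun c c' =>
    Disjoint ((chart c).symm '' Metric.closedBall 0 1) ((chart c').symm '' Metric.closedBall 0 1)
  /-- the arcs of the diagram outside the discs -/
  arc : Fin (2 * crossings) → C(I, X)
  /-- which point on the boundary of which disc is the initial point (`false`), respectively the
  terminal point (`true`), of an arc -/
  ends : Fin (2 * crossings) × Bool ≃ Fin crossings × Fin 4
  arc_zero : ∀ a, arc a 0 =
    (chart (ends (a, false)).1).symm (Complex.I ^ ((ends (a, false)).2 : ℕ))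
  arc_one : ∀ a, arc a 1 =
    (chart (ends (a, true)).1).symm (Complex.I ^ ((ends (a, true)).2 : ℕ))
  arc_injective : Function.Injective fun p : Fin (2 * crossings) × I => arc p.1 p.2
  arc_disc : ∀ a τ c, arc a τ ∈ (chart c).symm '' Metric.closedBall 0 1 → τ = 0 ∨ τ = 1
  /-- the components without crossings -/
  loop : Fin freeLoops → C(Circle, X)
  loop_injective : Function.Injective fun p : Fin freeLoops × Circle => loop p.1 p.2
  loop_disc : ∀ l z c, loop l z ∉ (chart c).symm '' Metric.closedBall 0 1
  loop_arc : ∀ l z a τ, loop l z ≠ arc a τ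

/-! ## States -/

/-- The two types of smoothings of a crossing. -/
inductive Smoothing
  | A
  | B

/-- The two arcs that replace the crossing of the (over) real axis and the (under) imaginary axis
in the unit disc. The `A`-smoothing joins the two regions swept out by rotating the overstrand
counterclockwise to the understrand, i.e. the first and the third quadrant; the `B`-smoothing joins
the other two. -/
def Smoothing.arcs : Smoothing → Set ℂ
  | .A => segment ℝ 1 (-Complex.I) ∪ segment ℝ Complex.I (-1)
  | .B => segment ℝ 1 Complex.I ∪ segment ℝ (-1) (-Complex.I)

namespace LinkDiagram

variable {X : Type u} [TopologicalSpace X] {o : SurfaceOrientation X}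

/-- A state of a diagram: a choice of a smoothing for each crossing. -/
abbrev State (D : LinkDiagram X o) : Type := Fin D.crossings → Smoothing

/-- The pure `A` state. -/
def stateA (D : LinkDiagram X o) : D.State := fun _ => .A

/-- The pure `B` state. -/
def stateB (D : LinkDiagram X o) : D.State := fun _ => .B

/-- Two states are adjacent if they differ at exactly one crossing. -/
def Adjacent (D : LinkDiagram X o) (S S' : D.State) : Prop := ∃! c, S c ≠ S' c

/-- The system of disjoint simple loops in the surface obtained by smoothing all crossings of `D`
as prescribed by the state `S`. -/
def smoothed (D : LinkDiagram X o) (S : D.State) : Set X :=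
  (⋃ a, Set.range (D.arc a)) ∪ (⋃ l, Set.range (D.loop l)) ∪
    ⋃ c, (D.chart c).symm '' (S c).arcs

end LinkDiagram

/-! ## Multi-loops in a surface -/

namespace MultiLoop

variable {X : Type u} [TopologicalSpace X]

/-- The inclusion of a subset of `X` as a continuous map. -/
def incl (M : Set X) : C(M, X) := ⟨Subtype.val, continuous_subtype_val⟩

/-- The loops of a system `M` of disjoint loops: its connected components. -/
def loops (M : Set X) : Set (Set X) := {C | ∃ x ∈ M, C = connectedComponentIn M x}

/-- A loop is contractible if its inclusion into the surface is homotopic to a constant map. -/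
def Contractible (C : Set X) : Prop := (incl C).Nullhomotopic

/-- `|M|`, the number of loops. -/
noncomputable def numLoops (M : Set X) : ℕ := (loops M).ncard

/-- `t(M)`, the number of contractible loops. -/
noncomputable def numContractible (M : Set X) : ℕ := {C ∈ loops M | Contractible C}.ncard

/-- `M` with all contractible loops removed. -/
def reduced (M : Set X) : Set X := ⋃₀ {C ∈ loops M | ¬ Contractible C}

/-- `M` and `M'` are isotopic: the inclusion of `M` can be deformed through embeddings to an
embedding with image `M'`. For non-trivial multi-loops this is equality in the set of isotopy
classes. -/
def Isotopic (M M' : Set X) : Prop :=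
  ∃ H : I × M → X, Continuous H ∧ (∀ τ, Topology.IsEmbedding fun x => H (τ, x)) ∧
    (∀ x : M, H (0, x) = x) ∧ Set.range (fun x => H (1, x)) = M'

/-- The map `H₁(M; ℤ/2) → H₁(X; ℤ/2)` induced by the inclusion, in singular homology. -/
noncomputable def homologyMap (M : Set X) :=
  ((AlgebraicTopology.singularHomologyFunctor (ModuleCat.{u} (ZMod 2)) 1).obj
    (ModuleCat.of (ZMod 2) (ULift.{u} (ZMod 2)))).map (TopCat.ofHom (incl M))

/-- `k(M)`, the rank of the kernel of `H₁(M; ℤ/2) → H₁(X; ℤ/2)`. -/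
noncomputable def kerRank (M : Set X) : ℕ := Module.finrank (ZMod 2) (LinearMap.ker (homologyMap M).hom)

end MultiLoop

/-! ## Notions of adequacy -/

namespace LinkDiagram

open MultiLoop

variable {X : Type u} [TopologicalSpace X] {o : SurfaceOrientation X}

/-- `D` is (skein) `A`-adequate. -/
def AAdequate (D : LinkDiagram X o) : Prop :=
  ∀ S, D.Adjacent S D.stateA →
    numContractible (D.smoothed S) ≤ numContractible (D.smoothed D.stateA) ∨
      ¬ Isotopic (reduced (D.smoothed S)) (reduced (D.smoothed D.stateA))

/-- `D` is (skein) `B`-adequate. -/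
def BAdequate (D : LinkDiagram X o) : Prop :=
  ∀ S, D.Adjacent S D.stateB →
    numContractible (D.smoothed S) ≤ numContractible (D.smoothed D.stateB) ∨
      ¬ Isotopic (reduced (D.smoothed S)) (reduced (D.smoothed D.stateB))

/-- `D` is homologically `A`-adequate. -/
def HomologicallyAAdequate (D : LinkDiagram X o) : Prop :=
  ∀ S, D.Adjacent S D.stateA → kerRank (D.smoothed S) ≤ kerRank (D.smoothed D.stateA)

/-- `D` is homologically `B`-adequate. -/
def HomologicallyBAdequate (D : LinkDiagram X o) : Prop :=
  ∀ S, D.Adjacent S D.stateB → kerRank (D.smoothed S) ≤ kerRank (D.smoothed D.stateB)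

/-- `D` is plus-adequate: `|S| = |S_A| - 1` for every state `S` adjacent to `S_A`. -/
def PlusAdequate (D : LinkDiagram X o) : Prop :=
  ∀ S, D.Adjacent S D.stateA → numLoops (D.smoothed S) + 1 = numLoops (D.smoothed D.stateA)

/-- `D` is minus-adequate: `|S| = |S_B| - 1` for every state `S` adjacent to `S_B`. -/
def MinusAdequate (D : LinkDiagram X o) : Prop :=
  ∀ S, D.Adjacent S D.stateB → numLoops (D.smoothed S) + 1 = numLoops (D.smoothed D.stateB)

end LinkDiagram

/-! For the loop system `M` of a state, write `t` for the number of contractible loops and `M̂` for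
`reduced M`. Two additivity formulas carry the proof: `|M| = t(M) + |M̂|` (`numLoops_eq_add`) and
`k(M) = t(M) + k(M̂)` (`kerRank_eq_add`). Both `|M̂|` and `k(M̂)` are isotopy invariants
(`Isotopic.numLoops_eq`, `Isotopic.kerRank_eq`). If adequacy failed at a state `S` adjacent to
`S_X`, then `Ŝ` would be isotopic to `Ŝ_X` while `t(S) > t(S_X)`. Hence `k(S) > k(S_X)` and `|S| >
|S_X|`, which contradicts homological adequacy and plus- or minus-adequacy respectively.

The formula for `k` rests on two facts about singular homology: `H₁` of a disjoint union is a direct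
sum (`coprod_bijective`), and `H₁` of a circle has rank one (`finrank_of_circle`). The latter is
obtained from the covering of the circle by the line, through a statement about simplicial sets
(`CyclicCover.nonempty_homology_iso`). A contractible circle then adds exactly one to the kernel.

It remains to know that a state really is a finite disjoint union of circles. The outer arcs and the
smoothing arcs are followed by a permutation of oriented arcs. Each orbit closes up to an embedded
circle (`ArcSystem.exists_homeomorph_circle`), and the rest of the system is closed and disjoint
from it, so this circle is a connected component. -/

/-! ## First homology of a simplicial set with an infinite cyclic cover -/

namespace CyclicCover

open CategoryTheory Limits Simplicial Opposite

universe v w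

variable {C : Type w} [Category.{v} C] [Abelian C]

/-- A homology object in degree one is identified with `R` by a cocycle `φ` and a cycle `ω` which
are inverse to each other up to a chain homotopy. -/
theorem nonempty_homology_iso_of_homotopy (K : ChainComplex C ℕ) (R : C) (φ : K.X 1 ⟶ R)
    (ω : R ⟶ K.X 1) (h₀ : K.X 0 ⟶ K.X 1) (h₁ : K.X 1 ⟶ K.X 2) (hφ : K.d 2 1 ≫ φ = 0)
    (hω : ω ≫ K.d 1 0 = 0) (hωφ : ω ≫ φ = 𝟙 R)
    (hh : h₁ ≫ K.d 2 1 = 𝟙 _ - K.d 1 0 ≫ h₀ - φ ≫ ω) : Nonempty (K.homology 1 ≅ R) := by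
  have hcyc : K.toCycles 2 1 ≫ K.iCycles 1 ≫ φ = 0 := by simp [hφ]
  let f : R ⟶ K.homology 1 := K.liftCycles ω 0 (by simp) hω ≫ K.homologyπ 1
  let g : K.homology 1 ⟶ R :=
    (K.homologyIsCokernel 2 1 (by simp)).desc (CokernelCofork.ofπ (K.iCycles 1 ≫ φ) hcyc)
  have hg : K.homologyπ 1 ≫ g = K.iCycles 1 ≫ φ :=
    (K.homologyIsCokernel 2 1 (by simp)).fac _ WalkingParallelPair.one
  refine ⟨⟨g, f, ?_, ?_⟩⟩
  · rw [← cancel_epi (K.homologyπ 1), reassoc_of% hg, Category.comp_id]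
    -- On cycles the term of `hh` that begins with the boundary vanishes, so `φ ≫ ω` differs from
    -- the identity only by a boundary.
    have key : K.iCycles 1 ≫ φ ≫ K.liftCycles ω 0 (by simp) hω =
        𝟙 _ - K.iCycles 1 ≫ h₁ ≫ K.toCycles 2 1 := by
      rw [← cancel_mono (K.iCycles 1)]
      simp only [Category.assoc, Preadditive.sub_comp, HomologicalComplex.liftCycles_i,
        HomologicalComplex.toCycles_i, hh, Preadditive.comp_sub, Category.comp_id,
        Category.id_comp, HomologicalComplex.iCycles_d_assoc, zero_comp]
      abel
    have := congrArg (· ≫ K.homologyπ 1) key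
    simpa [f] using this
  · simp [f, hg, hωφ]

variable [HasCoproducts.{u} C] {E X : SSet.{u}} (R : C)

/-- The morphism out of the object of `n`-chains with given restrictions to the summands. -/
noncomputable def chainDesc {X : SSet.{u}} {R T : C} {n : ℕ} (f : X _⦋n⦌ → (R ⟶ T)) :
    (X.chainComplex R).X n ⟶ T := Limits.Sigma.desc f

theorem ι_chainDesc {X : SSet.{u}} {R T : C} {n : ℕ} (f : X _⦋n⦌ → (R ⟶ T)) (x : X _⦋n⦌) :
    X.ιChainComplex x ≫ chainDesc f = f x := Limits.Sigma.ι_desc _ _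

theorem ι_chainDesc_assoc {X : SSet.{u}} {R T U : C} {n : ℕ} (f : X _⦋n⦌ → (R ⟶ T)) (g : T ⟶ U)
    (x : X _⦋n⦌) : X.ιChainComplex x ≫ chainDesc f ≫ g = f x ≫ g := by
  rw [← Category.assoc, ι_chainDesc]

/-- Two families of one-chains are homologous. -/
def Homologous {X : SSet.{u}} {R : C} (f g : R ⟶ (X.chainComplex R).X 1) : Prop :=
  ∃ T : R ⟶ (X.chainComplex R).X 2, T ≫ (X.chainComplex R).d 2 1 = f - g

namespace Homologous

variable {R} {f g h f' g' : R ⟶ (X.chainComplex R).X 1}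

theorem refl (f : R ⟶ (X.chainComplex R).X 1) : Homologous f f := ⟨0, by simp⟩

theorem symm : Homologous f g → Homologous g f := fun ⟨T, hT⟩ => ⟨-T, by simp [hT]⟩

theorem trans : Homologous f g → Homologous g h → Homologous f h :=
  fun ⟨T, hT⟩ ⟨T', hT'⟩ => ⟨T + T', by simp [hT, hT']⟩

theorem add : Homologous f g → Homologous f' g' → Homologous (f + f') (g + g') :=
  fun ⟨T, hT⟩ ⟨T', hT'⟩ => ⟨T + T', by simp only [Preadditive.add_comp, hT, hT']; abel⟩

theorem sub : Homologous f g → Homologous f' g' → Homologous (f - f') (g - g') :=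
  fun ⟨T, hT⟩ ⟨T', hT'⟩ => ⟨T - T', by simp only [Preadditive.sub_comp, hT, hT']; abel⟩

theorem map {f g : R ⟶ (E.chainComplex R).X 1} (π : E ⟶ X) :
    Homologous f g → Homologous (f ≫ (SSet.chainComplexMap π R).f 1)
      (g ≫ (SSet.chainComplexMap π R).f 1) :=
  fun ⟨T, hT⟩ => ⟨T ≫ (SSet.chainComplexMap π R).f 2, by
    rw [Category.assoc, HomologicalComplex.Hom.comm, ← Category.assoc, hT,
      Preadditive.sub_comp]⟩

end Homologous

theorem ι_d_one (x : X _⦋1⦌) :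
    X.ιChainComplex (R := R) x ≫ (X.chainComplex R).d 1 0 =
      X.ιChainComplex (X.δ 0 x) - X.ιChainComplex (X.δ 1 x) := by
  rw [SSet.ιChainComplex_d, Fin.sum_univ_two]
  simp [sub_eq_add_neg]

/-- The difference `f - g` lands in the cycles; by exactness these are the boundaries, and
projectivity of `R` lifts it to two-chains. -/
theorem homologous_of_exactAt [Projective R] (hex : (E.chainComplex R).ExactAt 1)
    {f g : R ⟶ (E.chainComplex R).X 1}
    (h : f ≫ (E.chainComplex R).d 1 0 = g ≫ (E.chainComplex R).d 1 0) : Homologous f g := by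
  have hex' := (HomologicalComplex.exactAt_iff' _ 2 1 0 (by simp) (by simp)).1 hex
  refine ⟨hex'.liftFromProjective (f - g) ?_, hex'.liftFromProjective_comp _ _⟩
  exact (Preadditive.sub_comp ..).trans (sub_eq_zero.2 h)

/-- Let `E → X` be an infinite cyclic cover of simplicial sets whose total space has vertex set
`ℝ`, and no first homology. Then the first homology of `X` is free of rank one. -/
theorem nonempty_homology_iso [Projective R] (π : E ⟶ X) (v : E _⦋0⦌ ≃ ℝ)
    (surj₀ : Function.Surjective (π.app (op ⦋0⦌)))
    (surj₁ : Function.Surjective (π.app (op ⦋1⦌)))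
    (surj₂ : Function.Surjective (π.app (op ⦋2⦌)))
    (hv : ∀ a b, π.app (op ⦋0⦌) a = π.app (op ⦋0⦌) b ↔ ∃ n : ℤ, v b = v a + n)
    (hlift : ∀ x y : E _⦋1⦌, π.app (op ⦋1⦌) x = π.app (op ⦋1⦌) y →
      ∃ n : ℤ, ∀ i, v (E.δ i y) = v (E.δ i x) + n)
    (hdeck : ∀ x : E _⦋1⦌, ∃ y : E _⦋1⦌, π.app (op ⦋1⦌) y = π.app (op ⦋1⦌) x ∧
      ∀ i, v (E.δ i y) = v (E.δ i x) + 1)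
    (hseg : ∀ a b : E _⦋0⦌, ∃ x : E _⦋1⦌, E.δ 1 x = a ∧ E.δ 0 x = b)
    (hex : (E.chainComplex R).ExactAt 1) : Nonempty (X.homology R 1 ≅ R) := by
  choose s hs using surj₀
  choose t ht using surj₁
  choose seg seg_one seg_zero using hseg
  -- `m c` will be the translation that takes the chosen point of the fibre to `c`.
  have hm : ∀ c : E _⦋0⦌, ∃ n : ℤ, v c = v (s (π.app _ c)) + n := fun c => (hv _ _).1 (hs _)
  choose m hm using hm
  have hm_add : ∀ a b : E _⦋0⦌, ∀ n : ℤ, v b = v a + n → m b = m a + n := by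
    intro a b n hab
    have h1 := hm a
    have h2 := hm b
    rw [← (hv a b).2 ⟨n, hab⟩] at h2
    have : (m b : ℝ) = m a + n := by linarith
    exact_mod_cast this
  have hδ : ∀ (i : Fin 2) (x : E _⦋1⦌), π.app (op ⦋0⦌) (E.δ i x) = X.δ i (π.app (op ⦋1⦌) x) :=
    fun i x => (ConcreteCategory.congr_hom (SimplicialObject.δ_naturality π i) x)
  let o : E _⦋0⦌ := v.symm 0
  let e : E _⦋0⦌ := v.symm 1
  let ω : R ⟶ (X.chainComplex R).X 1 := X.ιChainComplex (π.app _ (seg o e))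
  let mm : (E.chainComplex R).X 0 ⟶ R := Limits.Sigma.desc fun c => m c • 𝟙 R
  let φ : (X.chainComplex R).X 1 ⟶ R :=
    chainDesc fun q => (m (E.δ 0 (t q)) - m (E.δ 1 (t q))) • 𝟙 R
  have mm_ι : ∀ c, E.ιChainComplex c ≫ mm = m c • 𝟙 R := fun c => ι_chainDesc _ _
  have φ_ι : ∀ q, X.ιChainComplex q ≫ φ = (m (E.δ 0 (t q)) - m (E.δ 1 (t q))) • 𝟙 R :=
    fun q => ι_chainDesc _ _
  let P := SSet.chainComplexMap π R
  -- Pulled back to `E`, `φ` is the coboundary of `m`: another choice of lift shifts `m` equally at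
  -- both ends. Since `π` is onto on two-simplices, `φ` is therefore a cocycle.
  have hPφ : P.f 1 ≫ φ = (E.chainComplex R).d 1 0 ≫ mm := by
    ext x
    obtain ⟨n, hn⟩ := hlift (t (π.app _ x)) x (ht _)
    rw [SSet.ι_chainComplexMap_f_assoc, φ_ι, ← Category.assoc, ι_d_one, Preadditive.sub_comp,
      mm_ι, mm_ι, ← sub_smul, hm_add _ _ n (hn 0), hm_add _ _ n (hn 1)]
    congr 1
    ring
  have hdφ : (X.chainComplex R).d 2 1 ≫ φ = 0 := by
    ext y
    obtain ⟨x, rfl⟩ := surj₂ y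
    have h := congrArg (E.ιChainComplex x ≫ ·) (congrArg (· ≫ φ) (P.comm 2 1))
    simp only [Category.assoc, hPφ, HomologicalComplex.d_comp_d_assoc, zero_comp, comp_zero] at h
    rw [comp_zero, ← h, SSet.ι_chainComplexMap_f_assoc]
  have hnat : ∀ x : E _⦋1⦌, E.ιChainComplex (R := R) x ≫ P.f 1 = X.ιChainComplex (π.app _ x) :=
    fun x => SSet.ι_chainComplexMap_f _ _ _ _ x
  have step : ∀ c c' : E _⦋0⦌, v c' = v c + 1 →
      Homologous (X.ιChainComplex (R := R) (π.app _ (seg o c')))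
        (X.ιChainComplex (π.app _ (seg o c)) + ω) := by
    intro c c' hc
    -- The translate `y` of `seg o c` runs from `e` to `c'` and has the same image in `X`. In `E`,
    -- `seg o c'` is homologous to `seg o e` followed by `y`.
    obtain ⟨y, hy, hyv⟩ := hdeck (seg o c)
    have h1 : E.δ 1 y = e := v.injective (by rw [hyv, seg_one]; simp [o, e])
    have h0 : E.δ 0 y = c' := v.injective (by rw [hyv, seg_zero, hc])
    have := (homologous_of_exactAt R hex (f := E.ιChainComplex (seg o c'))
      (g := E.ιChainComplex y + E.ιChainComplex (seg o e)) (by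
        simp only [Preadditive.add_comp, ι_d_one, seg_one, seg_zero, h1, h0]; abel)).map π
    rw [Preadditive.add_comp] at this
    have h2 := hnat (seg o c')
    have h3 := hnat y
    have h4 := hnat (seg o e)
    simp only [P] at h2 h3 h4
    rwa [h2, h3, h4, hy] at this
  have steps : ∀ (n : ℤ) (c c' : E _⦋0⦌), v c' = v c + n →
      Homologous (X.ιChainComplex (R := R) (π.app _ (seg o c')))
        (X.ιChainComplex (π.app _ (seg o c)) + n • ω) := by
    intro n c
    induction n using Int.induction_on with
    | zero =>
      intro c' h
      obtain rfl : c' = c := v.injective (by simpa using h)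
      simpa using Homologous.refl _
    | succ k ih =>
      intro c' h
      have h1 := ih (v.symm (v c + k)) (by simp)
      have h2 := step (v.symm (v c + k)) c' (by rw [h]; simp; ring)
      refine h2.trans ?_
      have := h1.add (Homologous.refl ω)
      convert this using 1
      rw [add_smul, one_smul, add_assoc]
    | pred k ih =>
      intro c' h
      have h1 := ih (v.symm (v c + (-k : ℤ))) (by simp)
      have h2 := step c' (v.symm (v c + (-k : ℤ))) (by rw [h]; simp; ring)
      have := (h2.symm.trans h1).sub (Homologous.refl ω)
      convert this using 1
      · abel
      · rw [sub_smul, one_smul, add_sub_assoc]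
  let h₀ : (X.chainComplex R).X 0 ⟶ (X.chainComplex R).X 1 :=
    chainDesc fun x => X.ιChainComplex (π.app _ (seg o (s x)))
  have h₀_ι : ∀ x, X.ιChainComplex x ≫ h₀ = X.ιChainComplex (π.app _ (seg o (s x))) :=
    fun x => ι_chainDesc _ _
  -- In `E`, the lift `t q` is homologous to the difference of the segments from `o` to its two
  -- ends. By `steps`, each segment projects to the one ending at the chosen point of the fibre plus
  -- `m` copies of `ω`. The two-chains chosen here assemble to the homotopy.
  have hT : ∀ q : X _⦋1⦌, Homologous (X.ιChainComplex (R := R) q)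
      (X.ιChainComplex q ≫ (X.chainComplex R).d 1 0 ≫ h₀ + X.ιChainComplex q ≫ φ ≫ ω) := by
    intro q
    have h1 := (homologous_of_exactAt R hex (f := E.ιChainComplex (t q))
      (g := E.ιChainComplex (seg o (E.δ 0 (t q))) - E.ιChainComplex (seg o (E.δ 1 (t q)))) (by
        simp only [Preadditive.sub_comp, ι_d_one, seg_one, seg_zero]; abel)).map π
    rw [Preadditive.sub_comp] at h1
    have h2 := hnat (t q)
    have h3 := hnat (seg o (E.δ 0 (t q)))
    have h4 := hnat (seg o (E.δ 1 (t q)))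
    simp only [P] at h2 h3 h4
    rw [h2, h3, h4, ht] at h1
    have h5 := (steps _ _ _ (hm (E.δ 0 (t q)))).sub (steps _ _ _ (hm (E.δ 1 (t q))))
    refine h1.trans ?_
    convert h5 using 1
    rw [← Category.assoc, ι_d_one, Preadditive.sub_comp, h₀_ι, h₀_ι, ← Category.assoc, φ_ι,
      hδ, hδ, ht, sub_smul, Preadditive.sub_comp, Preadditive.zsmul_comp,
      Preadditive.zsmul_comp, Category.id_comp]
    abel
  choose T hT using hT
  refine nonempty_homology_iso_of_homotopy (X.chainComplex R) R φ ω h₀ (chainDesc T) hdφ ?_ ?_ ?_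
  · have : π.app (op ⦋0⦌) e = π.app (op ⦋0⦌) o := (hv _ _).2 ⟨-1, by simp [o, e]⟩
    rw [ι_d_one, ← hδ, ← hδ, seg_zero, seg_one, this, sub_self]
  · have h1 := hnat (seg o e)
    simp only [ω]
    rw [← h1, Category.assoc, hPφ, ← Category.assoc, ι_d_one, seg_zero, seg_one,
      Preadditive.sub_comp, mm_ι, mm_ι, hm_add o e 1 (by simp [o, e]), add_smul, add_sub_cancel_left,
      one_smul]
  · ext q
    rw [ι_chainDesc_assoc, hT]
    simp only [Preadditive.comp_sub, Category.comp_id]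
    abel

end CyclicCover

/-! ## First singular homology with coefficients in `ℤ/2` -/

namespace FirstHomology

/-! ### Linear algebra of direct sum decompositions -/

section LinearAlgebra

variable {K A B H W : Type*} [Field K] [AddCommGroup A] [AddCommGroup B] [AddCommGroup H]
  [AddCommGroup W] [Module K A] [Module K B] [Module K H] [Module K W]

theorem coprod_bijective_of_retractions {a : A →ₗ[K] H} {b : B →ₗ[K] H} {r : H →ₗ[K] A}
    {s : H →ₗ[K] B} (h₁ : r ∘ₗ a = LinearMap.id) (h₂ : r ∘ₗ b = 0) (h₃ : s ∘ₗ b = LinearMap.id)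
    (h₄ : s ∘ₗ a = 0) (h₅ : a ∘ₗ r + b ∘ₗ s = LinearMap.id) :
    Function.Bijective (a.coprod b) := by
  refine Function.bijective_iff_has_inverse.2 ⟨r.prod s, ?_, LinearMap.congr_fun h₅⟩
  rintro ⟨x, y⟩
  have e1 := LinearMap.congr_fun h₁ x
  have e2 := LinearMap.congr_fun h₂ y
  have e3 := LinearMap.congr_fun h₃ y
  have e4 := LinearMap.congr_fun h₄ x
  simp only [LinearMap.comp_apply, LinearMap.id_apply, LinearMap.zero_apply] at e1 e2 e3 e4
  simp [e1, e2, e3, e4]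

theorem coprod_bijective_of_subsingleton_left [Subsingleton A] (a : A →ₗ[K] H) {b : B →ₗ[K] H}
    (h : Function.Bijective b) : Function.Bijective (a.coprod b) := by
  refine ⟨fun p q hpq => ?_, fun c => ?_⟩
  · have e : p.1 = q.1 := Subsingleton.elim _ _
    simp only [LinearMap.coprod_apply, e] at hpq
    exact Prod.ext e (h.1 (add_left_cancel hpq))
  · obtain ⟨y, rfl⟩ := h.2 c
    exact ⟨(0, y), by simp⟩

theorem coprod_bijective_of_subsingleton_right [Subsingleton B] {a : A →ₗ[K] H} (b : B →ₗ[K] H)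
    (h : Function.Bijective a) : Function.Bijective (a.coprod b) := by
  refine ⟨fun p q hpq => ?_, fun c => ?_⟩
  · have e : p.2 = q.2 := Subsingleton.elim _ _
    simp only [LinearMap.coprod_apply, e] at hpq
    exact Prod.ext (h.1 (add_right_cancel hpq)) e
  · obtain ⟨x, rfl⟩ := h.2 c
    exact ⟨(x, 0), by simp⟩

/-- As `F` kills the image of `a`, its kernel corresponds to all of `A` times the kernel of `F ∘ₗ
b`. -/
theorem finrank_ker_of_coprod [Module.Finite K A] [Module.Finite K B] {a : A →ₗ[K] H}
    {b : B →ₗ[K] H} (h : Function.Bijective (a.coprod b)) (F : H →ₗ[K] W) (hF : F ∘ₗ a = 0) :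
    Module.finrank K (LinearMap.ker F) =
      Module.finrank K A + Module.finrank K (LinearMap.ker (F ∘ₗ b)) := by
  let e : (A × B) ≃ₗ[K] H := LinearEquiv.ofBijective _ h
  have he : ∀ p, F (e p) = F (b p.2) := fun p => by
    have := LinearMap.congr_fun hF p.1
    simp only [LinearMap.comp_apply, LinearMap.zero_apply] at this
    simp [e, this]
  let E : (A × LinearMap.ker (F ∘ₗ b)) ≃ₗ[K] LinearMap.ker F :=
    { toFun := fun p => ⟨e (p.1, p.2.1), by
        rw [LinearMap.mem_ker, he]; exact p.2.2⟩
      map_add' := fun p q => Subtype.ext (e.map_add (p.1, p.2.1) (q.1, q.2.1))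
      map_smul' := fun r p => Subtype.ext (e.map_smul r (p.1, p.2.1))
      invFun := fun p => ((e.symm p.1).1, ⟨(e.symm p.1).2, by
        rw [LinearMap.mem_ker, LinearMap.comp_apply, ← he, e.apply_symm_apply]; exact p.2⟩)
      left_inv := fun p => by simp
      right_inv := fun p => by simp }
  rw [← E.finrank_eq, Module.finrank_prod]

end LinearAlgebra

open CategoryTheory Limits Simplicial Opposite AlgebraicTopology

/-- The coefficient module. -/
abbrev coeff : ModuleCat.{u} (ZMod 2) := ModuleCat.of (ZMod 2) (ULift.{u} (ZMod 2))

/-- The first singular homology of a space with coefficients in `ℤ/2`. -/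
noncomputable abbrev H₁ (X : Type u) [TopologicalSpace X] : ModuleCat.{u} (ZMod 2) :=
  ((singularHomologyFunctor (ModuleCat.{u} (ZMod 2)) 1).obj coeff).obj (TopCat.of X)

/-- The map in first homology induced by a continuous map. -/
noncomputable def map {X Y : Type u} [TopologicalSpace X] [TopologicalSpace Y] (f : C(X, Y)) :
    H₁ X →ₗ[ZMod 2] H₁ Y :=
  (((singularHomologyFunctor (ModuleCat.{u} (ZMod 2)) 1).obj coeff).map (TopCat.ofHom f)).hom

/-- A singular simplex. -/
noncomputable def simplex {X : Type u} [TopologicalSpace X] {n : ℕ}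
    (f : C(stdSimplex ℝ (Fin (n + 1)), X)) : (TopCat.toSSet.obj (TopCat.of X)) _⦋n⦌ :=
  (TopCat.toSSetObjEquiv _ _).symm f

variable {X Y Z : Type u} [TopologicalSpace X] [TopologicalSpace Y] [TopologicalSpace Z]

theorem simplex_surjective (n : ℕ) : Function.Surjective (simplex (X := X) (n := n)) :=
  Equiv.surjective _

theorem simplex_injective (n : ℕ) : Function.Injective (simplex (X := X) (n := n)) :=
  Equiv.injective _

theorem map_simplex {n : ℕ} (f : C(stdSimplex ℝ (Fin (n + 1)), X)) (g : C(X, Y)) :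
    (TopCat.toSSet.map (TopCat.ofHom g)).app (op ⦋n⦌) (simplex f) = simplex (g.comp f) := rfl

theorem map_id : map (ContinuousMap.id X) = LinearMap.id := by
  have : TopCat.ofHom (ContinuousMap.id X) = 𝟙 (TopCat.of X) := rfl
  simp only [map, this, CategoryTheory.Functor.map_id]
  rfl

theorem map_comp (g : C(Y, Z)) (f : C(X, Y)) : map (g.comp f) = map g ∘ₗ map f := by
  have : TopCat.ofHom (g.comp f) = TopCat.ofHom f ≫ TopCat.ofHom g := rfl
  simp only [map, this, CategoryTheory.Functor.map_comp]
  rfl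

theorem map_eq_of_homotopic {f g : C(X, Y)} (h : f.Homotopic g) : map f = map g := by
  obtain ⟨H⟩ := h
  exact congrArg ModuleCat.Hom.hom (TopCat.Homotopy.congr_homologyMap_singularChainComplexFunctor
    (f := TopCat.ofHom f) (g := TopCat.ofHom g) H coeff 1)

theorem subsingleton_of_totallyDisconnected [TotallyDisconnectedSpace X] :
    Subsingleton (H₁ X) :=
  ModuleCat.subsingleton_of_isZero
    (isZero_singularHomologyFunctor_of_totallyDisconnectedSpace _ 1 coeff (TopCat.of X)
      one_ne_zero)

theorem map_eq_zero_of_factors (T : Type u) [TopologicalSpace T] [TotallyDisconnectedSpace T]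
    (f : C(X, T)) (g : C(T, Y)) : map (g.comp f) = 0 := by
  have := subsingleton_of_totallyDisconnected (X := T)
  ext x
  rw [map_comp, LinearMap.comp_apply, Subsingleton.elim (map f x) 0, _root_.map_zero]
  rfl

theorem map_const (y : Y) : map (ContinuousMap.const X y) = 0 :=
  map_eq_zero_of_factors PUnit (ContinuousMap.const X PUnit.unit) (ContinuousMap.const _ y)

theorem map_eq_zero_of_nullhomotopic {f : C(X, Y)} (h : f.Nullhomotopic) : map f = 0 := by
  obtain ⟨y, hy⟩ := h
  rw [map_eq_of_homotopic hy, map_const]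

theorem subsingleton_of_contractible [ContractibleSpace X] : Subsingleton (H₁ X) := by
  have h := map_eq_zero_of_nullhomotopic (id_nullhomotopic X)
  rw [map_id] at h
  exact ⟨fun a b => (LinearMap.congr_fun h a).trans (LinearMap.congr_fun h b).symm⟩

/-- A homeomorphism induces an isomorphism. -/
noncomputable def mapEquiv (e : X ≃ₜ Y) : H₁ X ≃ₗ[ZMod 2] H₁ Y :=
  LinearEquiv.ofLinearMap (map (e : C(X, Y))) (map (e.symm : C(Y, X)))
    (by rw [← map_comp, ← map_id]; congr 1; ext; simp)
    (by rw [← map_comp, ← map_id]; congr 1; ext; simp)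

/-- If two pairs of maps agree, up to order, on each singular simplex, then the sums of the induced
maps in homology are equal. -/
theorem map_add_map_eq {f g h l : C(X, Y)}
    (H : ∀ (n : ℕ) (q : C(stdSimplex ℝ (Fin (n + 1)), X)),
      f.comp q = h.comp q ∧ g.comp q = l.comp q ∨ f.comp q = l.comp q ∧ g.comp q = h.comp q) :
    map f + map g = map h + map l := by
  let P (a : C(X, Y)) := SSet.chainComplexMap (TopCat.toSSet.map (TopCat.ofHom a)) coeff
  have key : P f + P g = P h + P l := by
    ext n : 1
    refine SSet.chainComplex_hom_ext fun x => ?_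
    obtain ⟨q, rfl⟩ := simplex_surjective n x
    simp only [HomologicalComplex.add_f_apply, Preadditive.comp_add, P,
      SSet.ι_chainComplexMap_f, map_simplex]
    rcases H n q with ⟨h1, h2⟩ | ⟨h1, h2⟩
    · rw [h1, h2]
    · rw [h1, h2, add_comm]
  have := congrArg (fun a => (HomologicalComplex.homologyMap a 1)) key
  simp only [HomologicalComplex.homologyMap_add] at this
  exact congrArg ModuleCat.Hom.hom this

/-- The inclusion of the first summand of a disjoint union. -/
def inl : C(X, X ⊕ Y) := ⟨Sum.inl, continuous_inl⟩

/-- The inclusion of the second summand of a disjoint union. -/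
def inr : C(Y, X ⊕ Y) := ⟨Sum.inr, continuous_inr⟩

/-- The retraction of a disjoint union to the first summand. -/
def retractLeft (x : X) : C(X ⊕ Y, X) := ⟨Sum.elim id (Function.const Y x), by fun_prop⟩

/-- The retraction of a disjoint union to the second summand. -/
def retractRight (y : Y) : C(X ⊕ Y, Y) := ⟨Sum.elim (Function.const X y) id, by fun_prop⟩

theorem map_inl_comp_add_map_inr_comp (x : X) (y : Y) :
    map (inl (X := X) (Y := Y)) ∘ₗ map (retractLeft x) +
      map (inr (X := X) (Y := Y)) ∘ₗ map (retractRight y) = LinearMap.id := by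
  -- `b.comp a` sends each summand to the base point of the other. On a simplex, which lies in one
  -- summand, one of the two composites is the identity and the other agrees with `b.comp a`. The
  -- latter factors through a discrete space and is zero in homology.
  let T := ULift.{u} Bool
  let a : C(X ⊕ Y, T) := ⟨Sum.elim (fun _ => ⟨true⟩) (fun _ => ⟨false⟩), by fun_prop⟩
  let b : C(T, X ⊕ Y) := ⟨fun t => if t.down then Sum.inr y else Sum.inl x,
    continuous_of_discreteTopology⟩
  have hz : map (b.comp a) = 0 := map_eq_zero_of_factors T a b
  rw [← map_comp, ← map_comp, ← map_id, ← add_zero (map (ContinuousMap.id (X ⊕ Y))), ← hz]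
  refine map_add_map_eq fun n q => ?_
  have hc := (isPreconnected_univ (α := stdSimplex ℝ (Fin (n + 1)))).image q
    q.continuous.continuousOn
  have hcases : (∀ z, ∃ w, q z = Sum.inl w) ∨ (∀ z, ∃ w, q z = Sum.inr w) := by
    by_cases h : (q '' Set.univ ∩ Set.range Sum.inl).Nonempty
    · left
      intro z
      obtain ⟨w, hw⟩ := hc.subset_isClopen isClopen_range_inl h ⟨z, trivial, rfl⟩
      exact ⟨w, hw.symm⟩
    · right
      intro z
      rcases hz : q z with w | w
      · exact (h ⟨_, ⟨z, trivial, rfl⟩, ⟨w, hz.symm⟩⟩).elim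
      · exact ⟨w, rfl⟩
  rcases hcases with h | h
  · left
    constructor <;> ext z <;> obtain ⟨w, hw⟩ := h z <;>
      simp [hw, a, b, inl, inr, retractLeft, retractRight]
  · right
    constructor <;> ext z <;> obtain ⟨w, hw⟩ := h z <;>
      simp [hw, a, b, inl, inr, retractLeft, retractRight]

/-- The first homology of a disjoint union. -/
theorem coprod_bijective :
    Function.Bijective ((map (inl (X := X) (Y := Y))).coprod (map (inr (X := X) (Y := Y)))) := by
  -- The retractions need base points, so empty summands are treated separately.
  rcases isEmpty_or_nonempty X with hX | ⟨⟨x⟩⟩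
  · have := subsingleton_of_totallyDisconnected (X := X)
    exact coprod_bijective_of_subsingleton_left _
      (mapEquiv (Homeomorph.emptySum (X := Y) (Y := X)).symm).bijective
  rcases isEmpty_or_nonempty Y with hY | ⟨⟨y⟩⟩
  · have := subsingleton_of_totallyDisconnected (X := Y)
    exact coprod_bijective_of_subsingleton_right _
      (mapEquiv (Homeomorph.sumEmpty (X := X) (Y := Y)).symm).bijective
  refine coprod_bijective_of_retractions (r := map (retractLeft x)) (s := map (retractRight y))
    ?_ ?_ ?_ ?_ (map_inl_comp_add_map_inr_comp x y)
  · rw [← map_comp, ← map_id]; rfl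
  · rw [← map_comp]; exact map_const x
  · rw [← map_comp, ← map_id]; rfl
  · rw [← map_comp]; exact map_const y

theorem finite_sum [Module.Finite (ZMod 2) (H₁ X)] [Module.Finite (ZMod 2) (H₁ Y)] :
    Module.Finite (ZMod 2) (H₁ (X ⊕ Y)) :=
  Module.Finite.equiv (LinearEquiv.ofBijective _ coprod_bijective)

/-- The kernel in homology of a map on a disjoint union which is nullhomotopic on the first
summand. -/
theorem finrank_ker_sum [Module.Finite (ZMod 2) (H₁ X)] [Module.Finite (ZMod 2) (H₁ Y)]
    (f : C(X ⊕ Y, Z)) (hf : (f.comp inl).Nullhomotopic) :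
    Module.finrank (ZMod 2) (LinearMap.ker (map f)) =
      Module.finrank (ZMod 2) (H₁ X) +
        Module.finrank (ZMod 2) (LinearMap.ker (map (f.comp inr))) := by
  rw [map_comp]
  refine finrank_ker_of_coprod coprod_bijective _ ?_
  rw [← map_comp]
  exact map_eq_zero_of_nullhomotopic hf

/-- A homeomorphism does not change the kernel in homology. -/
theorem finrank_ker_comp_homeomorph (e : X ≃ₜ Y) (f : C(Y, Z)) :
    Module.finrank (ZMod 2) (LinearMap.ker (map (f.comp (e : C(X, Y))))) =
      Module.finrank (ZMod 2) (LinearMap.ker (map f)) := by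
  have : map (f.comp (e : C(X, Y))) = map f ∘ₗ (mapEquiv e).toLinearMap := map_comp _ _
  rw [this, LinearMap.ker_comp]
  have h := Submodule.comap_equiv_eq_map_symm (mapEquiv e) (LinearMap.ker (map f))
  exact (congrArg (fun S : Submodule (ZMod 2) (H₁ X) => Module.finrank (ZMod 2) S) h).trans
    (LinearEquiv.finrank_map_eq (mapEquiv e).symm _)

end FirstHomology

/-! ## The first homology of the circle -/

namespace FirstHomology

open CategoryTheory Limits Simplicial Opposite AlgebraicTopology

/-- Needed for simplices, as the domains of maps to be lifted along the covering of the circle. -/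
theorem locallyPathConnectedSpace_of_convex {V : Type*} [NormedAddCommGroup V] [NormedSpace ℝ V]
    {s : Set V} (hs : Convex ℝ s) : LocallyPathConnectedSpace s := by
  refine LocallyPathConnectedSpace.of_bases (p := fun _ (ε : ℝ) => 0 < ε)
    (s := fun x ε => Metric.ball x ε) (fun x => Metric.nhds_basis_ball) fun x ε hε => ?_
  have h : IsPathConnected (Metric.ball (x : V) ε ∩ s) :=
    ((convex_ball _ _).inter hs).isPathConnected ⟨x, Metric.mem_ball_self hε, x.2⟩
  have e : (Subtype.val ⁻¹' (Metric.ball (x : V) ε ∩ s) : Set s) = Metric.ball x ε := by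
    ext y; simp [Subtype.dist_eq]
  rw [← e]
  exact h.preimage_coe Set.inter_subset_right

instance (n : ℕ) : LocallyPathConnectedSpace (stdSimplex ℝ (Fin (n + 1))) :=
  locallyPathConnectedSpace_of_convex (convex_stdSimplex ℝ _)

instance (n : ℕ) : ContractibleSpace (stdSimplex ℝ (Fin (n + 1))) :=
  (convex_stdSimplex ℝ (Fin (n + 1))).contractibleSpace
    ⟨_, (stdSimplex.vertex (S := ℝ) (0 : Fin (n + 1))).2⟩

theorem coe_unitAddCircle_eq_iff (a b : ℝ) :
    (a : UnitAddCircle) = b ↔ ∃ n : ℤ, b = a + n := by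
  rw [eq_comm, ← sub_eq_zero, ← AddCircle.coe_sub, AddCircle.coe_eq_zero_iff]
  simp only [zsmul_eq_mul, mul_one]
  exact exists_congr fun n => ⟨fun h => by linarith, fun h => by linarith⟩

theorem exists_lift_unitAddCircle {n : ℕ} (q : C(stdSimplex ℝ (Fin (n + 1)), UnitAddCircle)) :
    ∃ Q : C(stdSimplex ℝ (Fin (n + 1)), ℝ), ∀ z, (Q z : UnitAddCircle) = q z := by
  obtain ⟨e₀, he⟩ := QuotientAddGroup.mk_surjective (q (stdSimplex.vertex 0))
  obtain ⟨Q, ⟨-, hQ⟩, -⟩ := (AddCircle.isCoveringMap_coe (1 : ℝ)).existsUnique_continuousMap_lifts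
    q (stdSimplex.vertex 0) e₀ he
  exact ⟨Q, congrFun hQ⟩

/-- The difference of two lifts is continuous and integer-valued, hence constant. -/
theorem exists_int_of_lifts {A : Type*} [TopologicalSpace A] [PreconnectedSpace A] (a₀ : A)
    (F G : C(A, ℝ)) (h : ∀ z, (F z : UnitAddCircle) = G z) : ∃ n : ℤ, ∀ z, G z = F z + n := by
  have h' := fun z => (coe_unitAddCircle_eq_iff _ _).1 (h z)
  choose k hk using h'
  have hc : Continuous k := by
    have : Continuous fun z => (k z : ℝ) := by
      have : (fun z => (k z : ℝ)) = fun z => G z - F z := by ext z; rw [hk]; ring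
      rw [this]; fun_prop
    exact Int.isClosedEmbedding_coe_real.isEmbedding.continuous_iff.2 this
  exact ⟨k a₀, fun z => by rw [hk, PreconnectedSpace.constant inferInstance hc]⟩

/-- The cyclic cover is the map of singular simplicial sets induced by `ℝ → Y`. Simplices lift, two
lifts differ by an integer, and `ℝ` is contractible, so its first homology vanishes. -/
theorem nonempty_equiv_of_circle {Y : Type u} [TopologicalSpace Y] (e : Y ≃ₜ UnitAddCircle) :
    Nonempty (H₁ Y ≅ coeff) := by
  let p : C(ULift.{u} ℝ, Y) :=
    ⟨fun t => e.symm (t.down : UnitAddCircle), by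
      exact e.symm.continuous.comp ((AddCircle.continuous_mk' 1).comp continuous_uliftDown)⟩
  have hp : ∀ a b, p a = p b ↔ ∃ n : ℤ, b.down = a.down + n := fun a b =>
    e.symm.injective.eq_iff.trans (coe_unitAddCircle_eq_iff _ _)
  let pt : stdSimplex ℝ (Fin (0 + 1)) := default
  let v : (TopCat.toSSet.obj (TopCat.of (ULift.{u} ℝ))) _⦋0⦌ ≃ ℝ :=
    { toFun := fun x => ((TopCat.toSSetObjEquiv _ _) x pt).down
      invFun := fun t => simplex (ContinuousMap.const _ ⟨t⟩)
      left_inv := fun x => by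
        obtain ⟨q, rfl⟩ := simplex_surjective 0 x
        refine congrArg simplex ?_
        ext z
        exact congrArg (fun z => (q z).down) (Subsingleton.elim _ _)
      right_inv := fun t => rfl }
  have hv : ∀ q, v (simplex q) = (q pt).down := fun q => rfl
  have hvδ : ∀ (q : C(stdSimplex ℝ (Fin (1 + 1)), ULift.{u} ℝ)) (i : Fin 2),
      v ((TopCat.toSSet.obj (TopCat.of (ULift.{u} ℝ))).δ i (simplex q)) =
        (q (stdSimplex.map i.succAbove pt)).down := fun q i => rfl
  have hsurj : ∀ n : ℕ, Function.Surjective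
      ((TopCat.toSSet.map (TopCat.ofHom p)).app (op ⦋n⦌)) := by
    intro n x
    obtain ⟨q, rfl⟩ := simplex_surjective n x
    obtain ⟨Q, hQ⟩ := exists_lift_unitAddCircle ((e : C(Y, UnitAddCircle)).comp q)
    refine ⟨simplex (ContinuousMap.comp ⟨ULift.up, continuous_uliftUp⟩ Q), ?_⟩
    rw [map_simplex]
    congr 1
    ext z
    have := hQ z
    simp only [ContinuousMap.comp_apply, ContinuousMap.coe_mk, p] at this ⊢
    rw [this]
    simp
  have : ContractibleSpace (ULift.{u} ℝ) := Homeomorph.ulift.contractibleSpace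
  have hex : ((TopCat.toSSet.obj (TopCat.of (ULift.{u} ℝ))).chainComplex coeff).ExactAt 1 := by
    rw [HomologicalComplex.exactAt_iff_isZero_homology]
    have := subsingleton_of_contractible (X := ULift.{u} ℝ)
    exact ModuleCat.isZero_of_subsingleton (H₁ (ULift.{u} ℝ))
  refine CyclicCover.nonempty_homology_iso (coeff : ModuleCat.{u} (ZMod 2))
    (TopCat.toSSet.map (TopCat.ofHom p)) v (hsurj 0) (hsurj 1) (hsurj 2) ?_ ?_ ?_ ?_ hex
  · intro a b
    obtain ⟨a, rfl⟩ := simplex_surjective 0 a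
    obtain ⟨b, rfl⟩ := simplex_surjective 0 b
    rw [map_simplex, map_simplex, (simplex_injective 0).eq_iff, hv, hv, ← hp]
    refine ⟨fun h => congrArg (fun q => q pt) h, fun h => ?_⟩
    ext z
    rw [Subsingleton.elim z pt]
    exact h
  · intro x y hxy
    obtain ⟨x, rfl⟩ := simplex_surjective 1 x
    obtain ⟨y, rfl⟩ := simplex_surjective 1 y
    rw [map_simplex, map_simplex, (simplex_injective 1).eq_iff] at hxy
    obtain ⟨n, hn⟩ := exists_int_of_lifts (stdSimplex.vertex 0)
      (ContinuousMap.comp ⟨ULift.down, continuous_uliftDown⟩ x)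
      (ContinuousMap.comp ⟨ULift.down, continuous_uliftDown⟩ y)
      (fun z => e.symm.injective (congrArg (fun q => q z) hxy))
    exact ⟨n, fun i => by rw [hvδ, hvδ]; exact hn _⟩
  · intro x
    obtain ⟨x, rfl⟩ := simplex_surjective 1 x
    refine ⟨simplex ⟨fun z => ⟨(x z).down + 1⟩, by fun_prop⟩, ?_, fun i => ?_⟩
    · rw [map_simplex, map_simplex]
      congr 1
      ext z
      exact (hp _ _).2 ⟨-1, by simp⟩
    · rw [hvδ, hvδ]; rfl
  · intro a b
    let q : C(stdSimplex ℝ (Fin (1 + 1)), ULift.{u} ℝ) :=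
      ⟨fun z => ⟨z.1 0 * v a + z.1 1 * v b⟩, continuous_uliftUp.comp
        ((((continuous_apply 0).comp continuous_subtype_val).mul_const _).add
          (((continuous_apply 1).comp continuous_subtype_val).mul_const _))⟩
    have hpt : pt = stdSimplex.vertex 0 := Subsingleton.elim _ _
    refine ⟨simplex q, v.injective ?_, v.injective ?_⟩
    · rw [hvδ, hpt, stdSimplex.map_vertex]
      simp [q]
    · rw [hvδ, hpt, stdSimplex.map_vertex]
      simp [q]

theorem finite_of_circle {Y : Type u} [TopologicalSpace Y] (e : Y ≃ₜ UnitAddCircle) :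
    Module.Finite (ZMod 2) (H₁ Y) := by
  obtain ⟨i⟩ := nonempty_equiv_of_circle e
  exact Module.Finite.equiv i.toLinearEquiv.symm

theorem finrank_of_circle {Y : Type u} [TopologicalSpace Y] (e : Y ≃ₜ UnitAddCircle) :
    Module.finrank (ZMod 2) (H₁ Y) = 1 := by
  obtain ⟨i⟩ := nonempty_equiv_of_circle e
  rw [i.toLinearEquiv.finrank_eq]
  exact (ULift.moduleEquiv (R := ZMod 2) (M := ZMod 2)).finrank_eq.trans (Module.finrank_self _)

end FirstHomology

/-! ## Circles obtained by gluing arcs -/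

/-- The disjoint closed sets `K` and `L` cover `M`, so the component of `x` lies in one of them, and
`x` is in `K`. -/
theorem connectedComponentIn_eq_of_isClosed {X : Type*} [TopologicalSpace X] {M K L : Set X} {x : X}
    (hx : x ∈ K) (hKM : K ⊆ M) (hK : IsPreconnected K) (hKc : IsClosed K) (hL : IsClosed L)
    (hM : M ⊆ K ∪ L) (hKL : Disjoint K L) : connectedComponentIn M x = K := by
  refine Set.Subset.antisymm ?_ (hK.subset_connectedComponentIn hx hKM)
  rcases isPreconnected_iff_subset_of_disjoint_closed.1 isPreconnected_connectedComponentIn K L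
    hKc hL ((connectedComponentIn_subset M x).trans hM) (by simp [hKL.inter_eq]) with h | h
  · exact h
  · exact (Set.disjoint_left.1 hKL hx (h (mem_connectedComponentIn (hKM hx)))).elim

/-- A family of arcs in `X`. The index set consists of the oriented arcs; `flip` reverses the
orientation, and `partner` is the other oriented arc with the same initial point. -/
structure ArcSystem (X : Type*) [TopologicalSpace X] (D : Type*) where
  /-- the arcs -/
  γ : D → C(I, X)
  /-- reversal of the orientation -/
  flip : Equiv.Perm D
  /-- the other arc with the same initial point -/
  partner : Equiv.Perm D
  flip_flip : ∀ x, flip (flip x) = x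
  partner_partner : ∀ x, partner (partner x) = x
  flip_ne : ∀ x, flip x ≠ x
  partner_ne : ∀ x, partner x ≠ x
  γ_flip : ∀ x s, γ (flip x) s = γ x (unitInterval.symm s)
  γ_partner : ∀ x, γ (partner x) 0 = γ x 0
  eq_cases : ∀ x y s t, γ x s = γ y t → (y = x ∧ t = s) ∨ (y = flip x ∧ t = unitInterval.symm s) ∨
    (y = partner x ∧ s = 0 ∧ t = 0) ∨ (y = flip (partner x) ∧ s = 0 ∧ t = 1) ∨
    (y = partner (flip x) ∧ s = 1 ∧ t = 0) ∨ (y = flip (partner (flip x)) ∧ s = 1 ∧ t = 1)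

namespace ArcSystem

variable {X D : Type*} [TopologicalSpace X] (A : ArcSystem X D)

/-- The successor of an oriented arc. -/
def next : Equiv.Perm D := A.partner * A.flip

theorem next_apply (x : D) : A.next x = A.partner (A.flip x) := rfl

theorem flip_mul_flip : A.flip * A.flip = 1 := Equiv.ext A.flip_flip

theorem partner_mul_partner : A.partner * A.partner = 1 := Equiv.ext A.partner_partner

theorem flip_inv : A.flip⁻¹ = A.flip := inv_eq_of_mul_eq_one_left A.flip_mul_flip

theorem next_inv : A.next⁻¹ = A.flip * A.partner := by
  rw [next, mul_inv_rev, A.flip_inv, inv_eq_of_mul_eq_one_left A.partner_mul_partner]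

/-- `next` is a product of two involutions, one of them `flip`, so conjugation by `flip` inverts it.
-/
theorem flip_next_zpow (k : ℤ) (x : D) : A.flip ((A.next ^ k) x) = (A.next ^ (-k)) (A.flip x) := by
  have h : A.flip * A.next * A.flip⁻¹ = A.next⁻¹ := by
    rw [A.next_inv, A.flip_inv, next, mul_assoc, mul_assoc, A.flip_mul_flip, mul_one]
  have h2 : A.flip * A.next ^ k * A.flip⁻¹ = A.next ^ (-k) := by
    rw [← conj_zpow, h, inv_zpow, zpow_neg]
  rw [← h2, A.flip_inv]
  simp [A.flip_flip]

/-- A path that came back along its own reversal would have to turn around halfway: inside an arc if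
`k` is even, giving a fixed point of `flip`, or at a vertex if `k` is odd, giving a fixed point of
`partner`. -/
theorem next_zpow_ne_flip (k : ℤ) (x : D) : (A.next ^ k) x ≠ A.flip x := by
  intro h
  obtain ⟨i, rfl | rfl⟩ := Int.even_or_odd' k
  · have h1 := A.flip_next_zpow i x
    rw [← h, ← Equiv.Perm.mul_apply (A.next ^ (-i)), ← zpow_add,
      show -i + 2 * i = i by ring] at h1
    exact A.flip_ne _ h1
  · have h1 := A.flip_next_zpow i x
    rw [← h, ← Equiv.Perm.mul_apply (A.next ^ (-i)), ← zpow_add,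
      show -i + (2 * i + 1) = 1 + i by ring, zpow_add, zpow_one, Equiv.Perm.mul_apply, next_apply] at h1
    exact A.partner_ne _ h1.symm

theorem next_zpow_ne_flip_zpow (j k : ℤ) (x : D) : (A.next ^ j) x ≠ A.flip ((A.next ^ k) x) := by
  have := A.next_zpow_ne_flip (j - k) ((A.next ^ k) x)
  rwa [← Equiv.Perm.mul_apply, ← zpow_add, sub_add_cancel] at this

theorem next_zpow_ne_partner_zpow (j k : ℤ) (x : D) :
    (A.next ^ j) x ≠ A.partner ((A.next ^ k) x) := by
  intro h
  apply A.next_zpow_ne_flip_zpow (j - 1) k x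
  rw [sub_eq_neg_add, zpow_add, zpow_neg_one, Equiv.Perm.mul_apply, h, A.next_inv,
    Equiv.Perm.mul_apply, A.partner_partner]

/-- The bi-infinite periodic concatenation of the successors of an arc. -/
noncomputable def line (x : D) (t : ℝ) : X :=
  A.γ ((A.next ^ ⌊t⌋) x) (Set.projIcc 0 1 zero_le_one (Int.fract t))

theorem γ_next_zero (x : D) : A.γ (A.next x) 0 = A.γ x 1 := by
  rw [next_apply, A.γ_partner, A.γ_flip, unitInterval.symm_zero]

/-- At `t = k + 1` the floor jumps to the next arc, but that arc starts where the previous one ends.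
The formula on closed intervals is what gives continuity. -/
theorem line_eq (x : D) (k : ℤ) {t : ℝ} (ht : t ∈ Set.Icc (k : ℝ) (k + 1)) :
    A.line x t = A.γ ((A.next ^ k) x) (Set.projIcc 0 1 zero_le_one (t - k)) := by
  rcases ht.2.eq_or_lt with h | h
  · subst h
    have h1 : ⌊(k : ℝ) + 1⌋ = k + 1 := by simp
    have h2 : Int.fract ((k : ℝ) + 1) = 0 := by simp
    have h3 : (k : ℝ) + 1 - k = 1 := by ring
    rw [line, h1, h2, h3, Set.projIcc_left, Set.projIcc_right, add_comm, zpow_add, zpow_one,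
      Equiv.Perm.mul_apply]
    exact A.γ_next_zero _
  · have h1 : ⌊t⌋ = k := Int.floor_eq_iff.2 ⟨ht.1, h⟩
    rw [line, Int.fract, h1]

theorem continuous_line (x : D) : Continuous (A.line x) := by
  have hf : LocallyFinite fun k : ℤ => Set.Icc (k : ℝ) (k + 1) :=
    locallyFinite_Icc_of_tendsto tendsto_intCast_atTop_atTop
      (Filter.tendsto_atBot_add_const_right _ _ (tendsto_intCast_atBot_iff.2 Filter.tendsto_id))
  refine hf.continuous ?_ (fun _ => isClosed_Icc) fun k => ?_
  · refine Set.eq_univ_of_forall fun t => Set.mem_iUnion.2 ⟨⌊t⌋, Int.floor_le t, ?_⟩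
    exact (Int.lt_floor_add_one t).le
  · refine ContinuousOn.congr (f := fun t =>
      A.γ ((A.next ^ k) x) (Set.projIcc 0 1 zero_le_one (t - k))) ?_ fun t ht => A.line_eq x k ht
    exact ((A.γ _).continuous.comp (continuous_projIcc.comp (by fun_prop))).continuousOn

theorem γ_mem_range_line (x : D) (k : ℤ) (s : I) :
    A.γ ((A.next ^ k) x) s ∈ Set.range (A.line x) := by
  refine ⟨s + k, ?_⟩
  rw [A.line_eq x k ⟨by linarith [s.2.1], by linarith [s.2.2]⟩, add_sub_cancel_right,
    Set.projIcc_val]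

/-- With `m` the length of the orbit of `x` under `next`, the line is `m`-periodic and injective on
`[0, m)`. It descends to a continuous injection of a circle into a Hausdorff space, which is an
embedding. -/
theorem exists_homeomorph_circle [Finite D] [T2Space X] (x : D) :
    IsCompact (Set.range (A.line x)) ∧ Nonempty (Set.range (A.line x) ≃ₜ UnitAddCircle) := by
  set m := MulAction.period A.next x
  have hpow : ∀ j : ℤ, (A.next ^ j) x = x ↔ (m : ℤ) ∣ j := fun j =>
    MulAction.zpow_smul_eq_iff_period_dvd (g := A.next) (a := x)
  have hpos : 0 < m := by
    refine MulAction.period_pos_of_fixed (n := orderOf A.next) (orderOf_pos _) ?_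
    rw [pow_orderOf_eq_one, one_smul]
  have hpos' : (0 : ℝ) < m := by exact_mod_cast hpos
  have hper : Function.Periodic (A.line x) (m : ℝ) := fun t => by
    have h1 : ⌊t + (m : ℝ)⌋ = ⌊t⌋ + m := by simp
    have h2 : Int.fract (t + (m : ℝ)) = Int.fract t := by simp
    rw [line, h1, h2, zpow_add, Equiv.Perm.mul_apply, (hpow m).2 dvd_rfl, line]
  let G : AddCircle (m : ℝ) → X := hper.lift
  have hG : Continuous G := (A.continuous_line x).quotient_lift _
  have hGr : Set.range G = Set.range (A.line x) := by
    ext y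
    constructor
    · rintro ⟨z, rfl⟩
      obtain ⟨t, rfl⟩ := QuotientAddGroup.mk_surjective z
      exact ⟨t, rfl⟩
    · rintro ⟨t, rfl⟩
      exact ⟨(t : AddCircle (m : ℝ)), rfl⟩
  have hinj : Function.Injective G := by
    have hline : ∀ t ∈ Set.Ico (0 : ℝ) m, ∀ t' ∈ Set.Ico (0 : ℝ) m,
        A.line x t = A.line x t' → t = t' := by
      intro t ht t' ht' h
      have hv : ∀ r : ℝ, ((Set.projIcc 0 1 zero_le_one (Int.fract r) : I) : ℝ) = Int.fract r :=
        fun r => by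
          rw [Set.projIcc_of_mem zero_le_one ⟨Int.fract_nonneg r, (Int.fract_lt_one r).le⟩]
      have hne : ∀ r : ℝ, (Set.projIcc 0 1 zero_le_one (Int.fract r) : I) ≠ 1 := fun r hr => by
        have := hv r
        rw [hr] at this
        exact (Int.fract_lt_one r).ne this.symm
      -- On the same arc, the floors agree modulo `m`, hence are equal. Meeting the reversal or the
      -- partner of an arc of the orbit is impossible, and the last three cases need a parameter
      -- `1`, which a fractional part never is.
      rcases A.eq_cases _ _ _ _ h with h | h | h | h | h | h
      · have hfl : ⌊t⌋ = ⌊t'⌋ := by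
          have h1 : (A.next ^ (⌊t'⌋ - ⌊t⌋)) x = x := by
            rw [sub_eq_neg_add, zpow_add, Equiv.Perm.mul_apply, h.1, ← Equiv.Perm.mul_apply,
              ← zpow_add, neg_add_cancel, zpow_zero, Equiv.Perm.one_apply]
          have h3 := (hpow _).1 h1
          have a1 : 0 ≤ ⌊t⌋ := Int.floor_nonneg.2 ht.1
          have a2 : 0 ≤ ⌊t'⌋ := Int.floor_nonneg.2 ht'.1
          have a3 : ⌊t⌋ < m := Int.floor_lt.2 (by exact_mod_cast ht.2)
          have a4 : ⌊t'⌋ < m := Int.floor_lt.2 (by exact_mod_cast ht'.2)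
          have := Int.eq_zero_of_abs_lt_dvd h3 (by rw [abs_lt]; constructor <;> linarith)
          linarith
        have hfr : Int.fract t = Int.fract t' := by rw [← hv t, ← hv t', h.2]
        rw [← Int.floor_add_fract t, ← Int.floor_add_fract t', hfl, hfr]
      · exact (A.next_zpow_ne_flip_zpow _ _ _ h.1).elim
      · exact (A.next_zpow_ne_partner_zpow _ _ _ h.1).elim
      · exact (hne _ h.2.2).elim
      · exact (hne _ h.2.1).elim
      · exact (hne _ h.2.1).elim
    have : Fact (0 < (m : ℝ)) := ⟨hpos'⟩
    intro z z' hzz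
    have hsurj := AddCircle.coe_image_Ico_eq (m : ℝ) 0
    obtain ⟨t, ht, rfl⟩ : z ∈ ((↑) : ℝ → AddCircle (m : ℝ)) '' Set.Ico 0 (0 + (m : ℝ)) := by
      rw [hsurj]; trivial
    obtain ⟨t', ht', rfl⟩ : z' ∈ ((↑) : ℝ → AddCircle (m : ℝ)) '' Set.Ico 0 (0 + (m : ℝ)) := by
      rw [hsurj]; trivial
    rw [zero_add] at ht ht'
    rw [hline t ht t' ht' hzz]
  have : Fact (0 < (m : ℝ)) := ⟨hpos'⟩
  have hemb := (hG.isClosedEmbedding hinj).isEmbedding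
  rw [← hGr]
  exact ⟨isCompact_range hG, ⟨hemb.toHomeomorph.symm.trans
    (AddCircle.homeomorphAddCircle (m : ℝ) 1 hpos'.ne' one_ne_zero)⟩⟩

/-- The arcs which are not met by the bi-infinite concatenation of arcs through `x`. -/
def remainder (x : D) : Set X :=
  ⋃ y ∈ {y | ∀ k : ℤ, y ≠ (A.next ^ k) x ∧ A.flip y ≠ (A.next ^ k) x}, Set.range (A.γ y)

theorem isCompact_remainder [Finite D] (x : D) : IsCompact (A.remainder x) :=
  (Set.toFinite _).isCompact_biUnion fun y _ => isCompact_range (A.γ y).continuous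

theorem range_line_subset (x : D) : Set.range (A.line x) ⊆ ⋃ y, Set.range (A.γ y) := by
  rintro _ ⟨t, rfl⟩
  exact Set.mem_iUnion.2 ⟨_, _, rfl⟩

theorem subset_range_line_union (x : D) :
    ⋃ y, Set.range (A.γ y) ⊆ Set.range (A.line x) ∪ A.remainder x := by
  refine Set.iUnion_subset fun y => ?_
  rintro _ ⟨s, rfl⟩
  by_cases hy : ∀ k : ℤ, y ≠ (A.next ^ k) x ∧ A.flip y ≠ (A.next ^ k) x
  · exact Or.inr (Set.mem_biUnion hy ⟨s, rfl⟩)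
  · left
    push Not at hy
    obtain ⟨k, hk⟩ := hy
    by_cases h : y = (A.next ^ k) x
    · rw [h]; exact A.γ_mem_range_line x k s
    · have := A.γ_mem_range_line x k (unitInterval.symm s)
      rwa [← hk h, A.γ_flip, unitInterval.symm_symm] at this

/-- By `eq_cases`, an arc that touches an arc of the orbit is, up to reversal, that arc, its
successor or its predecessor, and so belongs to the orbit. -/
theorem disjoint_range_line_remainder (x : D) :
    Disjoint (Set.range (A.line x)) (A.remainder x) := by
  rw [Set.disjoint_left]
  rintro _ ⟨t, rfl⟩ h
  simp only [remainder, Set.mem_iUnion, Set.mem_ofPred_eq] at h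
  obtain ⟨y, hy, s, hs⟩ := h
  have h1 : A.next ((A.next ^ ⌊t⌋) x) = (A.next ^ (1 + ⌊t⌋)) x := by
    rw [zpow_add, zpow_one, Equiv.Perm.mul_apply]
  have h2 : A.flip (A.partner ((A.next ^ ⌊t⌋) x)) = (A.next ^ (-1 + ⌊t⌋)) x := by
    rw [zpow_add, zpow_neg_one, Equiv.Perm.mul_apply, A.next_inv, Equiv.Perm.mul_apply]
  rcases A.eq_cases _ _ _ _ hs.symm with ⟨rfl, -⟩ | ⟨rfl, -⟩ | ⟨rfl, -⟩ | ⟨rfl, -⟩ | ⟨rfl, -⟩ |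
    ⟨rfl, -⟩
  · exact (hy _).1 rfl
  · exact (hy _).2 (A.flip_flip _)
  · exact (hy _).2 h2
  · exact (hy _).1 h2
  · exact (hy _).1 h1
  · exact (hy _).2 ((A.flip_flip _).trans h1)

theorem mem_range_line (x : D) (s : I) : A.γ x s ∈ Set.range (A.line x) := by
  simpa using A.γ_mem_range_line x 0 s

end ArcSystem

/-! ## The loops of a smoothed diagram -/

namespace Smoothing

/-- The corner of the unit disc which a smoothing joins to a given corner. -/
def mate : Smoothing → Fin 4 → Fin 4
  | .A => ![3, 2, 1, 0]
  | .B => ![1, 0, 3, 2]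

theorem mate_mate (S : Smoothing) (i : Fin 4) : S.mate (S.mate i) = i := by
  cases S <;> revert i <;> decide

theorem mate_ne (S : Smoothing) (i : Fin 4) : S.mate i ≠ i := by
  cases S <;> revert i <;> decide

/-- The points of the arc of the smoothing which starts at the corner `I ^ i`. -/
noncomputable def point (S : Smoothing) (i : Fin 4) (t : ℝ) : ℂ :=
  (1 - t) • Complex.I ^ (i : ℕ) + t • Complex.I ^ (S.mate i : ℕ)

theorem continuous_point (S : Smoothing) (i : Fin 4) : Continuous (S.point i) := by
  unfold point; fun_prop

theorem point_zero (S : Smoothing) (i : Fin 4) : S.point i 0 = Complex.I ^ (i : ℕ) := by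
  simp [point]

theorem point_mate (S : Smoothing) (i : Fin 4) (t : ℝ) :
    S.point (S.mate i) t = S.point i (1 - t) := by
  rw [point, point, mate_mate, sub_sub_cancel, add_comm]

theorem point_mem (S : Smoothing) (i : Fin 4) {t : ℝ} (ht : t ∈ Set.Icc (0 : ℝ) 1) :
    S.point i t ∈ Metric.closedBall (0 : ℂ) 1 :=
  convex_closedBall (0 : ℂ) 1 (by simp) (by simp) (by linarith [ht.2]) ht.1 (by ring)

/-- The two segments of a smoothing are disjoint, and each is parametrized once from either end;
coordinates decide every case. -/
theorem point_eq_point (S : Smoothing) {i j : Fin 4} {s t : ℝ} (hs : s ∈ Set.Icc (0 : ℝ) 1)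
    (ht : t ∈ Set.Icc (0 : ℝ) 1) (h : S.point i s = S.point j t) :
    (j = i ∧ t = s) ∨ (j = S.mate i ∧ t = 1 - s) := by
  obtain ⟨hs0, hs1⟩ := hs
  obtain ⟨ht0, ht1⟩ := ht
  have hre := congrArg Complex.re h
  have him := congrArg Complex.im h
  have e3 : Complex.I ^ 3 = -Complex.I := Complex.I_pow_three
  cases S <;> fin_cases i <;> fin_cases j <;> simp [point, mate, e3] at hre him ⊢ <;> linarith

theorem arcs_eq (S : Smoothing) : S.arcs = ⋃ i, S.point i '' Set.Icc 0 1 := by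
  have h : ∀ i, S.point i '' Set.Icc 0 1 =
      segment ℝ (Complex.I ^ (i : ℕ)) (Complex.I ^ (S.mate i : ℕ)) :=
    fun i => (segment_eq_image ℝ _ _).symm
  have e3 : Complex.I ^ 3 = -Complex.I := Complex.I_pow_three
  simp only [h]
  ext z
  simp only [Set.mem_iUnion, Fin.exists_fin_succ]
  cases S
  · simp [arcs, mate, e3, segment_symm ℝ (-Complex.I) 1, segment_symm ℝ (-1) Complex.I]
    tauto
  · simp [arcs, mate, e3, segment_symm ℝ Complex.I 1, segment_symm ℝ (-Complex.I) (-1)]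

end Smoothing

/-! ### The arc system of a state -/

namespace LinkDiagram

variable {X : Type u} [TopologicalSpace X] {o : SurfaceOrientation X} (D : LinkDiagram X o)

/-- The other end point of the arc starting at a corner of a disc. -/
def arcPartner : Equiv.Perm (Fin D.crossings × Fin 4) :=
  D.ends.symm.trans (((Equiv.refl _).prodCongr Equiv.boolNot).trans D.ends)

theorem arcPartner_ends (a : Fin (2 * D.crossings)) (b : Bool) :
    D.arcPartner (D.ends (a, b)) = D.ends (a, !b) := by
  simp [arcPartner]

/-- The arc starting at a corner of a disc. -/
def arcFrom (v : Fin D.crossings × Fin 4) : C(I, X) :=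
  if (D.ends.symm v).2 then
    (D.arc (D.ends.symm v).1).comp ⟨unitInterval.symm, unitInterval.continuous_symm⟩
  else D.arc (D.ends.symm v).1

theorem arcFrom_ends_false (a : Fin (2 * D.crossings)) (t : I) :
    D.arcFrom (D.ends (a, false)) t = D.arc a t := by
  simp [arcFrom]

theorem arcFrom_ends_true (a : Fin (2 * D.crossings)) (t : I) :
    D.arcFrom (D.ends (a, true)) t = D.arc a (unitInterval.symm t) := by
  simp [arcFrom]

theorem arcFrom_arcPartner (v : Fin D.crossings × Fin 4) (t : I) :
    D.arcFrom (D.arcPartner v) t = D.arcFrom v (unitInterval.symm t) := by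
  obtain ⟨⟨a, b⟩, rfl⟩ := D.ends.surjective v
  rw [arcPartner_ends]
  cases b <;> simp [arcFrom_ends_true, arcFrom_ends_false]

theorem arcFrom_zero (v : Fin D.crossings × Fin 4) :
    D.arcFrom v 0 = (D.chart v.1).symm (Complex.I ^ (v.2 : ℕ)) := by
  obtain ⟨⟨a, b⟩, rfl⟩ := D.ends.surjective v
  cases b
  · rw [arcFrom_ends_false, D.arc_zero]
  · rw [arcFrom_ends_true, unitInterval.symm_zero, D.arc_one]

theorem arcFrom_eq {v w : Fin D.crossings × Fin 4} {s t : I} (h : D.arcFrom v s = D.arcFrom w t) :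
    (w = v ∧ t = s) ∨ (w = D.arcPartner v ∧ t = unitInterval.symm s) := by
  obtain ⟨⟨a, b⟩, rfl⟩ := D.ends.surjective v
  obtain ⟨⟨a', b'⟩, rfl⟩ := D.ends.surjective w
  rw [arcPartner_ends]
  have inj : ∀ {s t : I}, D.arc a s = D.arc a' t → a = a' ∧ s = t := fun h => by
    have := @D.arc_injective (a, _) (a', _) h
    simpa using this
  cases b <;> cases b' <;> simp only [arcFrom_ends_true, arcFrom_ends_false] at h <;>
    obtain ⟨rfl, hst⟩ := inj h
  · exact Or.inl ⟨rfl, hst.symm⟩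
  · exact Or.inr ⟨rfl, by rw [hst, unitInterval.symm_symm]⟩
  · exact Or.inr ⟨rfl, hst.symm⟩
  · exact Or.inl ⟨rfl, (unitInterval.symm_bijective.injective hst).symm⟩

theorem arcFrom_disc {v : Fin D.crossings × Fin 4} {s : I} {c : Fin D.crossings}
    (h : D.arcFrom v s ∈ (D.chart c).symm '' Metric.closedBall 0 1) : s = 0 ∨ s = 1 := by
  obtain ⟨⟨a, b⟩, rfl⟩ := D.ends.surjective v
  cases b
  · rw [arcFrom_ends_false] at h
    exact D.arc_disc _ _ _ h
  · rw [arcFrom_ends_true] at h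
    have := D.arc_disc _ _ _ h
    rwa [unitInterval.symm_eq_zero, unitInterval.symm_eq_one, or_comm] at this

variable (S : D.State)

/-- The permutation of the corners given by the smoothings. -/
def smoothingPartner : Equiv.Perm (Fin D.crossings × Fin 4) :=
  Function.Involutive.toPerm (fun v => (v.1, (S v.1).mate v.2)) fun v => by
    simp [Smoothing.mate_mate]

theorem smoothingPartner_apply (v : Fin D.crossings × Fin 4) :
    D.smoothingPartner S v = (v.1, (S v.1).mate v.2) := rfl

/-- The arc of the smoothed crossing which starts at a corner. -/
noncomputable def smoothingFrom (v : Fin D.crossings × Fin 4) : C(I, X) :=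
  ⟨fun t => (D.chart v.1).symm ((S v.1).point v.2 t),
    (D.chart v.1).continuousOn_symm.comp_continuous
      (((S v.1).continuous_point v.2).comp continuous_subtype_val)
      fun t => D.closedBall_subset _ ((S v.1).point_mem _ t.2)⟩

theorem smoothingFrom_apply (v : Fin D.crossings × Fin 4) (t : I) :
    D.smoothingFrom S v t = (D.chart v.1).symm ((S v.1).point v.2 t) := rfl

theorem smoothingFrom_mem (v : Fin D.crossings × Fin 4) (t : I) :
    D.smoothingFrom S v t ∈ (D.chart v.1).symm '' Metric.closedBall 0 1 :=
  ⟨_, (S v.1).point_mem _ t.2, rfl⟩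

theorem smoothingFrom_zero (v : Fin D.crossings × Fin 4) :
    D.smoothingFrom S v 0 = D.arcFrom v 0 := by
  rw [arcFrom_zero, smoothingFrom_apply, Set.Icc.coe_zero, Smoothing.point_zero]

theorem smoothingFrom_smoothingPartner (v : Fin D.crossings × Fin 4) (t : I) :
    D.smoothingFrom S (D.smoothingPartner S v) t = D.smoothingFrom S v (unitInterval.symm t) := by
  rw [smoothingPartner_apply, smoothingFrom_apply, smoothingFrom_apply, Smoothing.point_mate,
    unitInterval.coe_symm_eq]

theorem smoothingFrom_eq {v w : Fin D.crossings × Fin 4} {s t : I}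
    (h : D.smoothingFrom S v s = D.smoothingFrom S w t) :
    (w = v ∧ t = s) ∨ (w = D.smoothingPartner S v ∧ t = unitInterval.symm s) := by
  obtain ⟨c, i⟩ := v
  obtain ⟨d, j⟩ := w
  obtain rfl : c = d := by
    by_contra hcd
    have h1 := D.smoothingFrom_mem S (c, i) s
    rw [h] at h1
    exact Set.disjoint_left.1 (D.disjoint_discs hcd) h1 (D.smoothingFrom_mem S (d, j) t)
  have h1 : (S c).point i s = (S c).point j t :=
    (D.chart c).symm.injOn (D.closedBall_subset c ((S c).point_mem i s.2))
      (D.closedBall_subset c ((S c).point_mem j t.2)) h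
  rcases (S c).point_eq_point s.2 t.2 h1 with ⟨rfl, h2⟩ | ⟨rfl, h2⟩
  · exact Or.inl ⟨rfl, Subtype.ext h2⟩
  · exact Or.inr ⟨rfl, Subtype.ext h2⟩

/-- An outer arc meets the discs only at its ends. There the point is a corner, where a smoothing
arc also starts, so the question reduces to `smoothingFrom_eq`. -/
theorem arcFrom_eq_smoothingFrom {v w : Fin D.crossings × Fin 4} {s t : I}
    (h : D.arcFrom v s = D.smoothingFrom S w t) :
    (w = v ∧ s = 0 ∧ t = 0) ∨ (w = D.smoothingPartner S v ∧ s = 0 ∧ t = 1) ∨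
      (w = D.arcPartner v ∧ s = 1 ∧ t = 0) ∨
      (w = D.smoothingPartner S (D.arcPartner v) ∧ s = 1 ∧ t = 1) := by
  have hs : s = 0 ∨ s = 1 := D.arcFrom_disc (h ▸ D.smoothingFrom_mem S w t)
  rcases hs with rfl | rfl
  · rw [← D.smoothingFrom_zero S] at h
    rcases D.smoothingFrom_eq S h with ⟨h1, h2⟩ | ⟨h1, h2⟩
    · exact Or.inl ⟨h1, rfl, h2⟩
    · exact Or.inr (Or.inl ⟨h1, rfl, by rw [h2, unitInterval.symm_zero]⟩)
  · rw [← unitInterval.symm_zero, ← D.arcFrom_arcPartner, ← D.smoothingFrom_zero S] at h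
    rcases D.smoothingFrom_eq S h with ⟨h1, h2⟩ | ⟨h1, h2⟩
    · exact Or.inr (Or.inr (Or.inl ⟨h1, rfl, h2⟩))
    · exact Or.inr (Or.inr (Or.inr ⟨h1, rfl, by rw [h2, unitInterval.symm_zero]⟩))

theorem arcPartner_arcPartner (v : Fin D.crossings × Fin 4) :
    D.arcPartner (D.arcPartner v) = v := by
  obtain ⟨⟨a, b⟩, rfl⟩ := D.ends.surjective v
  rw [arcPartner_ends, arcPartner_ends, Bool.not_not]

theorem smoothingPartner_smoothingPartner (v : Fin D.crossings × Fin 4) :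
    D.smoothingPartner S (D.smoothingPartner S v) = v := by
  simp [smoothingPartner_apply, Smoothing.mate_mate]

/-- The arcs outside the discs together with the arcs of the smoothed crossings. -/
noncomputable def arcSystem :
    ArcSystem X ((Fin D.crossings × Fin 4) ⊕ (Fin D.crossings × Fin 4)) where
  γ := Sum.elim D.arcFrom (D.smoothingFrom S)
  flip := Equiv.sumCongr D.arcPartner (D.smoothingPartner S)
  -- At each corner exactly one outer arc and one smoothing arc start; `partner` exchanges them.
  partner := Equiv.sumComm _ _
  flip_flip := by
    rintro (v | v)
    · exact congrArg Sum.inl (D.arcPartner_arcPartner v)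
    · exact congrArg Sum.inr (D.smoothingPartner_smoothingPartner S v)
  partner_partner := by rintro (v | v) <;> rfl
  flip_ne := by
    rintro (v | v) h
    · obtain ⟨⟨a, b⟩, rfl⟩ := D.ends.surjective v
      have h1 : D.arcPartner (D.ends (a, b)) = D.ends (a, b) := Sum.inl_injective h
      rw [arcPartner_ends] at h1
      simpa using D.ends.injective h1
    · have h1 : D.smoothingPartner S v = v := Sum.inr_injective h
      exact (S v.1).mate_ne v.2 (congrArg Prod.snd h1)
  partner_ne := by rintro (v | v) h <;> simp at h
  γ_flip := by
    rintro (v | v) t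
    · exact D.arcFrom_arcPartner v t
    · exact D.smoothingFrom_smoothingPartner S v t
  γ_partner := by
    rintro (v | v)
    · exact D.smoothingFrom_zero S v
    · exact (D.smoothingFrom_zero S v).symm
  eq_cases := by
    rintro (v | v) (w | w) s t h
    · rcases D.arcFrom_eq h with ⟨rfl, hst⟩ | ⟨rfl, hst⟩
      · exact Or.inl ⟨rfl, hst⟩
      · exact Or.inr (Or.inl ⟨rfl, hst⟩)
    · rcases D.arcFrom_eq_smoothingFrom S h with ⟨rfl, hst⟩ | ⟨rfl, hst⟩ | ⟨rfl, hst⟩ | ⟨rfl, hst⟩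
      · exact Or.inr (Or.inr (Or.inl ⟨rfl, hst⟩))
      · exact Or.inr (Or.inr (Or.inr (Or.inl ⟨rfl, hst⟩)))
      · exact Or.inr (Or.inr (Or.inr (Or.inr (Or.inl ⟨rfl, hst⟩))))
      · exact Or.inr (Or.inr (Or.inr (Or.inr (Or.inr ⟨rfl, hst⟩))))
    · rcases D.arcFrom_eq_smoothingFrom S h.symm with ⟨rfl, hst⟩ | ⟨rfl, hst⟩ | ⟨rfl, hst⟩ | ⟨rfl, hst⟩
      · exact Or.inr (Or.inr (Or.inl ⟨rfl, hst.2, hst.1⟩))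
      · refine Or.inr (Or.inr (Or.inr (Or.inr (Or.inl ⟨?_, hst.2, hst.1⟩))))
        exact congrArg Sum.inl (D.smoothingPartner_smoothingPartner S w).symm
      · refine Or.inr (Or.inr (Or.inr (Or.inl ⟨?_, hst.2, hst.1⟩)))
        exact congrArg Sum.inl (D.arcPartner_arcPartner w).symm
      · refine Or.inr (Or.inr (Or.inr (Or.inr (Or.inr ⟨?_, hst.2, hst.1⟩))))
        refine congrArg Sum.inl ?_
        rw [smoothingPartner_smoothingPartner, arcPartner_arcPartner]
    · rcases D.smoothingFrom_eq S h with ⟨rfl, hst⟩ | ⟨rfl, hst⟩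
      · exact Or.inl ⟨rfl, hst⟩
      · exact Or.inr (Or.inl ⟨rfl, hst⟩)

theorem iUnion_range_arc : ⋃ a, Set.range (D.arc a) = ⋃ v, Set.range (D.arcFrom v) := by
  refine Set.Subset.antisymm (Set.iUnion_subset fun a => ?_) (Set.iUnion_subset fun v => ?_)
  · rintro _ ⟨t, rfl⟩
    exact Set.mem_iUnion.2 ⟨D.ends (a, false), t, D.arcFrom_ends_false a t⟩
  · rintro _ ⟨t, rfl⟩
    obtain ⟨⟨a, b⟩, rfl⟩ := D.ends.surjective v
    cases b
    · exact Set.mem_iUnion.2 ⟨a, t, (D.arcFrom_ends_false a t).symm⟩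
    · exact Set.mem_iUnion.2 ⟨a, _, (D.arcFrom_ends_true a t).symm⟩

theorem iUnion_chart_arcs :
    ⋃ c, (D.chart c).symm '' (S c).arcs = ⋃ v, Set.range (D.smoothingFrom S v) := by
  refine Set.Subset.antisymm (Set.iUnion_subset fun c => ?_) (Set.iUnion_subset fun v => ?_)
  · rintro _ ⟨z, hz, rfl⟩
    rw [Smoothing.arcs_eq] at hz
    obtain ⟨i, t, ht, rfl⟩ := Set.mem_iUnion.1 hz
    exact Set.mem_iUnion.2 ⟨(c, i), ⟨t, ht⟩, rfl⟩
  · rintro _ ⟨t, rfl⟩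
    refine Set.mem_iUnion.2 ⟨v.1, _, ?_, rfl⟩
    rw [Smoothing.arcs_eq]
    exact Set.mem_iUnion.2 ⟨v.2, t, t.2, rfl⟩

theorem smoothed_eq : D.smoothed S =
    (⋃ x, Set.range ((D.arcSystem S).γ x)) ∪ ⋃ l, Set.range (D.loop l) := by
  rw [smoothed, iUnion_range_arc, iUnion_chart_arcs, Set.union_right_comm, Set.iUnion_sum]
  rfl

theorem disjoint_arcSystem_loop (l : Fin D.freeLoops) :
    Disjoint (⋃ x, Set.range ((D.arcSystem S).γ x)) (Set.range (D.loop l)) := by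
  rw [Set.disjoint_left]
  rintro _ h ⟨z, rfl⟩
  obtain ⟨v | v, t, ht⟩ := Set.mem_iUnion.1 h
  · have h1 : D.loop l z ∈ ⋃ a, Set.range (D.arc a) := by
      rw [iUnion_range_arc]
      exact Set.mem_iUnion.2 ⟨v, t, ht⟩
    obtain ⟨a, t, ht⟩ := Set.mem_iUnion.1 h1
    exact D.loop_arc l z a t ht.symm
  · refine D.loop_disc l z v.1 ?_
    rw [← ht]
    exact D.smoothingFrom_mem S v t

end LinkDiagram

/-! ### The loops of a state are finitely many embedded circles -/

namespace MultiLoop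

variable {X : Type u} [TopologicalSpace X]

/-- A subset which is homeomorphic to the circle. -/
def IsCircle (C : Set X) : Prop := IsCompact C ∧ Nonempty (C ≃ₜ UnitAddCircle)

theorem IsCircle.isPreconnected {C : Set X} (h : IsCircle C) : IsPreconnected C := by
  obtain ⟨-, ⟨e⟩⟩ := h
  have h1 : IsPreconnected (Set.univ : Set UnitAddCircle) := by
    rw [← AddCircle.coe_image_Icc_eq (1 : ℝ) 0]
    exact isPreconnected_Icc.image _ (AddCircle.continuous_mk' 1).continuousOn
  have h2 := h1.image (fun z => (e.symm z : X)) (by fun_prop)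
  convert h2
  ext x
  refine ⟨fun hx => ⟨e ⟨x, hx⟩, trivial, by simp⟩, ?_⟩
  rintro ⟨z, -, rfl⟩
  exact (e.symm z).2

end MultiLoop

namespace LinkDiagram

open MultiLoop

variable {X : Type u} [TopologicalSpace X] [T2Space X] {o : SurfaceOrientation X}
  (D : LinkDiagram X o) (S : D.State)

theorem isCircle_range_loop (l : Fin D.freeLoops) : IsCircle (Set.range (D.loop l)) := by
  have hinj : Function.Injective (D.loop l) := fun z w h => by
    have := @D.loop_injective (l, z) (l, w) h
    simpa using this
  refine ⟨isCompact_range (D.loop l).continuous, ⟨?_⟩⟩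
  have h := ((D.loop l).continuous.isClosedEmbedding hinj).isEmbedding.toHomeomorph.symm
  exact h.trans ((AddCircle.homeomorphCircle one_ne_zero).symm)

/-- The other arcs and the free loops form a compact, hence closed, set disjoint from the circle
through `x`. -/
theorem connectedComponentIn_smoothed_line (x) {p : X}
    (hp : p ∈ Set.range ((D.arcSystem S).line x)) :
    connectedComponentIn (D.smoothed S) p = Set.range ((D.arcSystem S).line x) := by
  have hc := (D.arcSystem S).exists_homeomorph_circle x
  have hloops : IsCompact (⋃ l, Set.range (D.loop l)) :=
    isCompact_iUnion fun l => isCompact_range (D.loop l).continuous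
  refine connectedComponentIn_eq_of_isClosed
    (L := (D.arcSystem S).remainder x ∪ ⋃ l, Set.range (D.loop l)) hp ?_
    (IsCircle.isPreconnected hc) hc.1.isClosed
    (((D.arcSystem S).isCompact_remainder x).union hloops).isClosed ?_ ?_
  · rw [smoothed_eq]
    exact ((D.arcSystem S).range_line_subset x).trans Set.subset_union_left
  · rw [smoothed_eq, ← Set.union_assoc]
    exact Set.union_subset_union_left _ ((D.arcSystem S).subset_range_line_union x)
  · refine Disjoint.union_right ((D.arcSystem S).disjoint_range_line_remainder x) ?_
    refine Disjoint.mono_left ((D.arcSystem S).range_line_subset x) ?_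
    exact Set.disjoint_iUnion_right.2 fun l => D.disjoint_arcSystem_loop S l

theorem connectedComponentIn_smoothed_loop (l : Fin D.freeLoops) {p : X}
    (hp : p ∈ Set.range (D.loop l)) :
    connectedComponentIn (D.smoothed S) p = Set.range (D.loop l) := by
  have hc := D.isCircle_range_loop l
  have harcs : IsCompact (⋃ x, Set.range ((D.arcSystem S).γ x)) :=
    isCompact_iUnion fun x => isCompact_range ((D.arcSystem S).γ x).continuous
  have hloops : IsCompact (⋃ m : {m // m ≠ l}, Set.range (D.loop m)) :=
    isCompact_iUnion fun m => isCompact_range (D.loop m).continuous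
  refine connectedComponentIn_eq_of_isClosed (L := (⋃ x, Set.range ((D.arcSystem S).γ x)) ∪
    ⋃ m : {m // m ≠ l}, Set.range (D.loop m)) hp ?_ hc.isPreconnected hc.1.isClosed
    (harcs.union hloops).isClosed ?_ ?_
  · rw [smoothed_eq]
    exact (Set.subset_iUnion (fun l => Set.range (D.loop l)) l).trans Set.subset_union_right
  · rw [smoothed_eq]
    refine Set.union_subset (fun y hy => Or.inr (Or.inl hy)) (Set.iUnion_subset fun m y hy => ?_)
    by_cases h : m = l
    · exact Or.inl (h ▸ hy)
    · exact Or.inr (Or.inr (Set.mem_iUnion.2 ⟨⟨m, h⟩, hy⟩))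
  · refine Disjoint.union_right (D.disjoint_arcSystem_loop S l).symm
      (Set.disjoint_iUnion_right.2 fun m => Set.disjoint_left.2 ?_)
    rintro _ ⟨z, rfl⟩ ⟨w, hw⟩
    have := @D.loop_injective (m, w) (l, z) hw
    exact m.2 (congrArg Prod.fst this)

theorem loops_smoothed_subset : loops (D.smoothed S) ⊆
    (Set.range fun x => Set.range ((D.arcSystem S).line x)) ∪
      Set.range fun l => Set.range (D.loop l) := by
  rintro _ ⟨p, hp, rfl⟩
  rw [smoothed_eq] at hp
  rcases hp with hp | hp
  · obtain ⟨x, s, rfl⟩ := Set.mem_iUnion.1 hp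
    exact Or.inl ⟨x, (D.connectedComponentIn_smoothed_line S x
      ((D.arcSystem S).mem_range_line x s)).symm⟩
  · obtain ⟨l, hl⟩ := Set.mem_iUnion.1 hp
    exact Or.inr ⟨l, (D.connectedComponentIn_smoothed_loop S l hl).symm⟩

theorem finite_loops_smoothed : (loops (D.smoothed S)).Finite :=
  ((Set.finite_range _).union (Set.finite_range _)).subset (D.loops_smoothed_subset S)

theorem isCircle_of_mem_loops_smoothed {C : Set X} (hC : C ∈ loops (D.smoothed S)) :
    IsCircle C := by
  rcases D.loops_smoothed_subset S hC with ⟨x, rfl⟩ | ⟨l, rfl⟩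
  · exact (D.arcSystem S).exists_homeomorph_circle x
  · exact D.isCircle_range_loop l

end LinkDiagram

/-! ## Contractible loops, homology and isotopy -/

namespace MultiLoop

theorem disjoint_sUnion_of_notMem {α : Type*} {𝒞 : Set (Set α)} {C : Set α} (hC : C ∉ 𝒞)
    (h : (insert C 𝒞).PairwiseDisjoint id) : Disjoint C (⋃₀ 𝒞) :=
  Set.disjoint_sUnion_right.2 fun _ hC' => h (Set.mem_insert _ _) (Set.mem_insert_of_mem _ hC')
    fun h => hC (h ▸ hC')

open FirstHomology

variable {X : Type u} [TopologicalSpace X]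

theorem kerRank_eq (M : Set X) :
    kerRank M = Module.finrank (ZMod 2) (LinearMap.ker (map (incl M))) := rfl

/-- The disjoint union of two disjoint compact subsets of a Hausdorff space. -/
noncomputable def unionHomeomorph [T2Space X] {A B : Set X} (hA : IsCompact A) (hB : IsCompact B)
    (hAB : Disjoint A B) : (A ⊕ B) ≃ₜ (A ∪ B : Set X) :=
  have := isCompact_iff_compactSpace.1 hA
  have := isCompact_iff_compactSpace.1 hB
  let f : (A ⊕ B) → (A ∪ B : Set X) :=
    Sum.elim (Set.inclusion Set.subset_union_left) (Set.inclusion Set.subset_union_right)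
  have hf : Continuous f :=
    (continuous_inclusion Set.subset_union_left).sumElim
      (continuous_inclusion Set.subset_union_right)
  have hb : Function.Bijective f := by
    refine ⟨Function.Injective.sumElim (Set.inclusion_injective _) (Set.inclusion_injective _)
      fun a b h => ?_, ?_⟩
    · exact Set.disjoint_left.1 hAB a.2 ((congrArg Subtype.val h : (a : X) = b) ▸ b.2)
    · rintro ⟨x, hx | hx⟩
      · exact ⟨Sum.inl ⟨x, hx⟩, rfl⟩
      · exact ⟨Sum.inr ⟨x, hx⟩, rfl⟩
  Continuous.homeoOfEquivCompactToT2 (f := Equiv.ofBijective f hb) hf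

theorem finite_union [T2Space X] {A B : Set X} (hA : IsCompact A) (hB : IsCompact B)
    (hAB : Disjoint A B) [Module.Finite (ZMod 2) (H₁ A)] [Module.Finite (ZMod 2) (H₁ B)] :
    Module.Finite (ZMod 2) (H₁ (A ∪ B : Set X)) :=
  have := finite_sum (X := A) (Y := B)
  Module.Finite.equiv (mapEquiv (unionHomeomorph hA hB hAB))

theorem kerRank_union [T2Space X] {A B : Set X} (hA : IsCompact A) (hB : IsCompact B)
    (hAB : Disjoint A B) [Module.Finite (ZMod 2) (H₁ A)] [Module.Finite (ZMod 2) (H₁ B)]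
    (hc : Contractible A) :
    kerRank (A ∪ B) = Module.finrank (ZMod 2) (H₁ A) + kerRank B := by
  rw [kerRank_eq, ← finrank_ker_comp_homeomorph (unionHomeomorph hA hB hAB)]
  exact finrank_ker_sum ((incl (A ∪ B)).comp
    (unionHomeomorph hA hB hAB : C(A ⊕ B, (A ∪ B : Set X)))) hc

/-- Finiteness of `H₁` is needed because `finrank` is zero, and not additive, in infinite dimension.
-/
theorem isCompact_sUnion_and_finite [T2Space X] {𝒞 : Set (Set X)} (hfin : 𝒞.Finite)
    (hcirc : ∀ C ∈ 𝒞, IsCircle C) (hdisj : 𝒞.PairwiseDisjoint id) :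
    IsCompact (⋃₀ 𝒞) ∧ Module.Finite (ZMod 2) (H₁ (⋃₀ 𝒞)) := by
  induction 𝒞, hfin using Set.Finite.induction_on with
  | empty =>
    rw [Set.sUnion_empty]
    have := subsingleton_of_totallyDisconnected (X := (∅ : Set X))
    exact ⟨isCompact_empty, inferInstance⟩
  | @insert C 𝒞 hC hfin ih =>
    obtain ⟨h1, h2⟩ := ih (fun C' hC' => hcirc C' (Set.mem_insert_of_mem _ hC'))
      (hdisj.subset (Set.subset_insert _ _))
    obtain ⟨h3, ⟨e⟩⟩ := hcirc C (Set.mem_insert _ _)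
    have h4 := finite_of_circle e
    rw [Set.sUnion_insert]
    exact ⟨h3.union h1, finite_union h3 h1 (disjoint_sUnion_of_notMem hC hdisj)⟩

/-- Circles are split off one at a time: a contractible one maps to zero in homology, so its whole
rank-one `H₁` goes into the kernel. -/
theorem kerRank_sUnion_union [T2Space X] {𝒞 : Set (Set X)} {R : Set X} (hfin : 𝒞.Finite)
    (hcirc : ∀ C ∈ 𝒞, IsCircle C) (hdisj : 𝒞.PairwiseDisjoint id)
    (hcontr : ∀ C ∈ 𝒞, Contractible C) (hR : IsCompact R) [Module.Finite (ZMod 2) (H₁ R)]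
    (hRdisj : Disjoint (⋃₀ 𝒞) R) : kerRank (⋃₀ 𝒞 ∪ R) = 𝒞.ncard + kerRank R := by
  induction 𝒞, hfin using Set.Finite.induction_on with
  | empty => simp
  | @insert C 𝒞 hC hfin ih =>
    rw [Set.sUnion_insert, Set.disjoint_union_left] at hRdisj
    have hcirc' : ∀ C' ∈ 𝒞, IsCircle C' := fun C' hC' => hcirc C' (Set.mem_insert_of_mem _ hC')
    have hdisj' := hdisj.subset (Set.subset_insert C 𝒞)
    have h1 := ih hcirc' hdisj' (fun C' hC' => hcontr C' (Set.mem_insert_of_mem _ hC')) hRdisj.2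
    obtain ⟨h2, h3⟩ := isCompact_sUnion_and_finite hfin hcirc' hdisj'
    have h4 := finite_union h2 hR hRdisj.2
    obtain ⟨h5, ⟨e⟩⟩ := hcirc C (Set.mem_insert _ _)
    have h6 := finite_of_circle e
    have h7 : Disjoint C (⋃₀ 𝒞 ∪ R) :=
      Disjoint.union_right (disjoint_sUnion_of_notMem hC hdisj) hRdisj.1
    rw [Set.sUnion_insert, Set.union_assoc, kerRank_union h5 (h2.union hR) h7
      (hcontr C (Set.mem_insert _ _)), finrank_of_circle e, h1, Set.ncard_insert_of_notMem hC hfin]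
    ring

theorem pairwiseDisjoint_loops (M : Set X) : (loops M).PairwiseDisjoint id := by
  rintro _ ⟨x, hx, rfl⟩ _ ⟨y, hy, rfl⟩ h
  refine Set.disjoint_left.2 fun z hz hz' => h ?_
  exact (connectedComponentIn_eq hz).trans (connectedComponentIn_eq hz').symm

theorem sUnion_loops (M : Set X) : ⋃₀ loops M = M := by
  refine Set.Subset.antisymm (Set.sUnion_subset ?_) fun x hx =>
    ⟨_, ⟨x, hx, rfl⟩, mem_connectedComponentIn hx⟩
  rintro _ ⟨x, hx, rfl⟩
  exact connectedComponentIn_subset M x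

/-- The contractible loops contribute their number to the rank of the kernel. -/
theorem kerRank_eq_add [T2Space X] {M : Set X} (hfin : (loops M).Finite)
    (hcirc : ∀ C ∈ loops M, IsCircle C) :
    kerRank M = numContractible M + kerRank (reduced M) := by
  obtain ⟨h1, h2⟩ := isCompact_sUnion_and_finite (𝒞 := {C ∈ loops M | ¬ Contractible C})
    (hfin.subset (Set.sep_subset _ _)) (fun C hC => hcirc C hC.1)
    ((pairwiseDisjoint_loops M).subset (Set.sep_subset _ _))
  have hM : M = ⋃₀ {C ∈ loops M | Contractible C} ∪ reduced M := by
    rw [reduced, ← Set.sUnion_union, ← Set.sep_or]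
    simp only [em, Set.sep_true, sUnion_loops]
  have hd : Disjoint (⋃₀ {C ∈ loops M | Contractible C}) (reduced M) := by
    refine Set.disjoint_sUnion_left.2 fun C hC => Set.disjoint_sUnion_right.2 fun C' hC' => ?_
    exact pairwiseDisjoint_loops M hC.1 hC'.1 fun h => hC'.2 (h ▸ hC.2)
  have h3 := kerRank_sUnion_union (𝒞 := {C ∈ loops M | Contractible C})
    (hfin.subset (Set.sep_subset _ _)) (fun C hC => hcirc C hC.1)
    ((pairwiseDisjoint_loops M).subset (Set.sep_subset _ _)) (fun C hC => hC.2) h1 hd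
  exact (congrArg kerRank hM).trans h3

/-- A retained component stays connected inside `reduced M`, and it cannot grow because `reduced M ⊆
M`. -/
theorem loops_reduced (M : Set X) : loops (reduced M) = {C ∈ loops M | ¬ Contractible C} := by
  have hsub : reduced M ⊆ M := Set.sUnion_subset fun C hC => by
    conv_rhs => rw [← sUnion_loops M]
    exact Set.subset_sUnion_of_mem hC.1
  have key : ∀ C ∈ {C ∈ loops M | ¬ Contractible C}, ∀ x ∈ C,
      connectedComponentIn (reduced M) x = C := by
    rintro C hC x hx
    have hCr : C ⊆ reduced M := Set.subset_sUnion_of_mem hC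
    obtain ⟨y, hy, rfl⟩ := hC.1
    refine Set.Subset.antisymm ?_
      (isPreconnected_connectedComponentIn.subset_connectedComponentIn hx hCr)
    rw [connectedComponentIn_eq hx]
    exact connectedComponentIn_mono x hsub
  ext C
  constructor
  · rintro ⟨x, ⟨C', hC', hx⟩, rfl⟩
    rwa [key C' hC' x hx]
  · intro hC
    obtain ⟨y, hy, hCy⟩ := hC.1
    have hyC : y ∈ C := hCy ▸ mem_connectedComponentIn hy
    exact ⟨y, ⟨C, hC, hyC⟩, (key C hC y hyC).symm⟩

theorem numLoops_eq_add {M : Set X} (hfin : (loops M).Finite) :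
    numLoops M = numContractible M + numLoops (reduced M) := by
  have hd : Disjoint {C ∈ loops M | Contractible C} {C ∈ loops M | ¬ Contractible C} :=
    Set.disjoint_left.2 fun C hC hC' => hC'.2 hC.2
  rw [numLoops, numLoops, loops_reduced, numContractible,
    ← Set.ncard_union_eq hd (hfin.subset (Set.sep_subset _ _)) (hfin.subset (Set.sep_subset _ _)),
    ← Set.sep_or]
  simp only [em, Set.sep_true]

/-- An intrinsic description of the count, from which invariance under homeomorphism follows. -/
theorem numLoops_eq_card (M : Set X) : numLoops M = Nat.card (ConnectedComponents M) := by
  rw [numLoops, ← Nat.card_coe_set_eq]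
  refine (Nat.card_congr (Equiv.ofBijective (Quotient.lift (s := connectedComponentSetoid M)
    (fun x : M => (⟨connectedComponentIn M x, x, x.2, rfl⟩ : loops M)) ?_) ⟨?_, ?_⟩)).symm
  · intro x y h
    have h : connectedComponent x = connectedComponent y := h
    simp only [connectedComponentIn_eq_image x.2, connectedComponentIn_eq_image y.2,
      Subtype.coe_eta, h]
  · rintro ⟨x⟩ ⟨y⟩ h
    have h : connectedComponentIn M (x : X) = connectedComponentIn M (y : X) :=
      congrArg Subtype.val h
    rw [connectedComponentIn_eq_image x.2, connectedComponentIn_eq_image y.2] at h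
    exact Quotient.sound (s := connectedComponentSetoid M)
      (Subtype.val_injective.image_injective h)
  · rintro ⟨_, x, hx, rfl⟩
    exact ⟨Quotient.mk _ ⟨x, hx⟩, rfl⟩

theorem numLoops_eq_of_homeomorph {M M' : Set X} (e : M ≃ₜ M') : numLoops M = numLoops M' := by
  rw [numLoops_eq_card, numLoops_eq_card]
  exact Nat.card_congr
    { toFun := e.continuous.connectedComponentsMap
      invFun := e.symm.continuous.connectedComponentsMap
      left_inv := by rintro ⟨x⟩; exact congrArg _ (e.symm_apply_apply x)
      right_inv := by rintro ⟨x⟩; exact congrArg _ (e.apply_symm_apply x) }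

/-- The final embedding of the isotopy is a homeomorphism onto `M'`, and the isotopy itself is the
homotopy. This is all that `numLoops` and `kerRank` need. -/
theorem Isotopic.exists_homeomorph {M M' : Set X} (h : Isotopic M M') :
    ∃ e : M ≃ₜ M', (incl M).Homotopic ((incl M').comp (e : C(M, M'))) := by
  obtain ⟨H, hH, hemb, h0, h1⟩ := h
  let e : M ≃ₜ M' := (hemb 1).toHomeomorph.trans (Homeomorph.setCongr h1)
  exact ⟨e, ⟨{ toFun := H, continuous_toFun := hH, map_zero_left := h0,
               map_one_left := fun x => rfl }⟩⟩

theorem Isotopic.numLoops_eq {M M' : Set X} (h : Isotopic M M') : numLoops M = numLoops M' :=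
  let ⟨e, _⟩ := h.exists_homeomorph
  numLoops_eq_of_homeomorph e

theorem Isotopic.kerRank_eq {M M' : Set X} (h : Isotopic M M') : kerRank M = kerRank M' := by
  obtain ⟨e, he⟩ := h.exists_homeomorph
  rw [MultiLoop.kerRank_eq, map_eq_of_homotopic he, finrank_ker_comp_homeomorph,
    MultiLoop.kerRank_eq]

end MultiLoop

/-! ### Comparison of two states and the main theorem -/

namespace LinkDiagram

open MultiLoop

variable {X : Type u} [TopologicalSpace X] [T2Space X] {o : SurfaceOrientation X}
  (D : LinkDiagram X o) {S T : D.State}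

theorem kerRank_lt_of_isotopic
    (ht : numContractible (D.smoothed T) < numContractible (D.smoothed S))
    (h : Isotopic (reduced (D.smoothed S)) (reduced (D.smoothed T))) :
    kerRank (D.smoothed T) < kerRank (D.smoothed S) := by
  rw [kerRank_eq_add (D.finite_loops_smoothed S) fun C => D.isCircle_of_mem_loops_smoothed S,
    kerRank_eq_add (D.finite_loops_smoothed T) fun C => D.isCircle_of_mem_loops_smoothed T,
    h.kerRank_eq]
  exact Nat.add_lt_add_right ht _

theorem numLoops_lt_of_isotopic
    (ht : numContractible (D.smoothed T) < numContractible (D.smoothed S))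
    (h : Isotopic (reduced (D.smoothed S)) (reduced (D.smoothed T))) :
    numLoops (D.smoothed T) < numLoops (D.smoothed S) := by
  rw [numLoops_eq_add (D.finite_loops_smoothed S), numLoops_eq_add (D.finite_loops_smoothed T),
    h.numLoops_eq]
  exact Nat.add_lt_add_right ht _

theorem le_or_not_isotopic_of_kerRank_le
    (h : kerRank (D.smoothed S) ≤ kerRank (D.smoothed T)) :
    numContractible (D.smoothed S) ≤ numContractible (D.smoothed T) ∨
      ¬ Isotopic (reduced (D.smoothed S)) (reduced (D.smoothed T)) :=
  or_iff_not_imp_left.2 fun ht hi => (D.kerRank_lt_of_isotopic (not_le.1 ht) hi).not_ge h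

theorem le_or_not_isotopic_of_numLoops_le
    (h : numLoops (D.smoothed S) ≤ numLoops (D.smoothed T)) :
    numContractible (D.smoothed S) ≤ numContractible (D.smoothed T) ∨
      ¬ Isotopic (reduced (D.smoothed S)) (reduced (D.smoothed T)) :=
  or_iff_not_imp_left.2 fun ht hi => (D.numLoops_lt_of_isotopic (not_le.1 ht) hi).not_ge h

end LinkDiagram

theorem mainTheorem10 {X : Type*} [TopologicalSpace X] [T2Space X] [SecondCountableTopology X]
    [ChartedSpace (EuclideanHalfSpace 2) X] (o : SurfaceOrientation X) (D : LinkDiagram X o) :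
    (D.HomologicallyAAdequate → D.AAdequate) ∧ (D.HomologicallyBAdequate → D.BAdequate) ∧
      (D.PlusAdequate → D.AAdequate) ∧ (D.MinusAdequate → D.BAdequate) :=
  ⟨fun h S hS => D.le_or_not_isotopic_of_kerRank_le (h S hS),
    fun h S hS => D.le_or_not_isotopic_of_kerRank_le (h S hS),
    -- Of the equality `|S| + 1 = |S_X|` only `|S| ≤ |S_X|` is needed.
    fun h S hS => D.le_or_not_isotopic_of_numLoops_le (Nat.le_of_succ_le (h S hS).le),
    fun h S hS => D.le_or_not_isotopic_of_numLoops_le (Nat.le_of_succ_le (h S hS).le)⟩
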